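/- **Setting.** Fix an integer $k\ge 1$. For $0<p<1$ the generalized AR(1) model is $$\sum_{i=1}^k Y_{i,n}=\begin{cases}\sum_{i=1}^k \varepsilon_{i,n} & \text{with probability } p,\\[2pt] \sum_{i=1}^k Y_{i,n-1}+\sum_{i=1}^k\varepsilon_{i,n} & \text{with probability } 1-p,\end{cases}\qquad n\ge 1,$$ where for each $n$ the variables $Y_{1,n},\dots,Y_{k,n}$ are i.i.d., the innovations $\varepsilon_{i,n}$ are i.i.d. (over all $i,n$), the choices at different times are made by i.i.d. Bernoulli($p$) variables independent of the innovations, and the innovations and Bernoulli variables after time $n$ are jointly independent of $(Y_{i,m})_{m\le n,\,i\le k}$. It is stationary if the process $n\mapsto (Y_{1,n},\dots,Y_{k,n})$ is strictly stationary and all $Y_{i,n}$ have the same law. The Harris$(a,k)$ law ($a>1$) has probability generating function (PGF) $P_{a}(s)=s/\{a-(a-1)s^k\}^{1/k}$. A probability law on $\mathbb R$ with characteristic function (CF) $f$ is *gamma-ID* if, with $\varphi(s)=(1+s)^{-1/k}$ (the Laplace transform of a gamma law), there are integers $j\ge0$, $m\ge1$, a sequence $\theta_n>0$, $\theta_n\to0$,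 and CFs $h_n$ such that $P_{\theta_n}(h_n(t))\to f(t)$ for all $t$, where $P_\theta(s)=s^j\varphi((1-s^m)/\theta)$. For an infinitely divisible CF $h$, $\log h$ is its continuous logarithm with $\log h(0)=0$. Roots $z^{1/k}$ are principal. **Theorem 4.2.** Let $f$ be the CF of a probability law $\mu$ on $\mathbb R$ and let $p_n\in(0,1)$, $p_n\to0$. 1. The following are equivalent: (a) there are innovation laws, with CFs $f_{\varepsilon,p_n}$, such that for every $n$ the model with $p=p_n$ and this innovation law has a stationary solution in which the $Y_{i,\cdot}$ have law $\mu$; (b) $\mu$ is gamma-ID with CF $$f(t)=\frac{1}{\{1+k(-\log h(t))\}^{1/k}}\qquad(t\in\mathbb R)\tag{$*$}$$ for some infinitely divisible CF $h$. 2. For any innovation laws as in 1(a), $(*)$ holds with an infinitely divisible CF $h$ which is the limiting CF of the classical sums of the innovations along $\{p_n\}$: $h(t)=\lim_{n\to\infty} f_{\varepsilon,p_n}(t)^{\lfloor 1/p_n\rfloor}$ for all $t$. 3. For any sequence of probability laws with CFs $f_{\varepsilon,p_n}$, stationarity in the limit, $$f(t)=\lim_{n\to\infty}P_{1/p_n}\big(f_{\varepsilon,p_n}(t)\big)=\lim_{n\to\infty}\frac{p_n^{1/k}f_{\varepsilon,p_n}(t)}{\{1-(1-p_n)f_{\varepsilon,p_n}^k(t)\}^{1/k}}\qquad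 (t\in\mathbb R),$$ holds if and only if $\mu$ is gamma-ID and $(*)$ holds with an infinitely divisible CF $h$ such that $h(t)=\lim_{n\to\infty} f_{\varepsilon,p_n}(t)^{\lfloor 1/p_n\rfloor}$ for all $t$. -/

import Mathlib

open MeasureTheory ProbabilityTheory Filter Topology

noncomputable section

/-- The probability generating function of the Harris(a,k) law on `{1, 1 + k, 1 + 2k, …}`,
`P(s) = s / {a - (a - 1) s ^ k} ^ (1 / k)`, for complex `s` in the closed unit disc. For `1 < a` the
number under the root has real part at least `1` there, so that the principal root is meant. -/
def harrisPGF (a : ℝ) (k : ℕ) (s : ℂ) : ℂ :=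
  s / ((a : ℂ) - ((a : ℂ) - 1) * s ^ k) ^ (1 / (k : ℂ))

/-- The probability generating functions `P_θ(s) = s ^ j φ((1 - s ^ m) / θ)` attached to a Laplace
transform `φ`. -/
def phiPGF (φ : ℂ → ℂ) (j m : ℕ) (θ : ℝ) (s : ℂ) : ℂ :=
  s ^ j * φ ((1 - s ^ m) / (θ : ℂ))

/-- A law `μ` is `φ`-infinitely divisible if its characteristic function is a limit of
`P_θ(h_θ)`, with characteristic functions `h_θ` and the generating functions `P_θ` of the class
attached to `φ` (for some `j ≥ 0` and `m ≥ 1`), as `θ ↓ 0` through a sequence `θ_n`. -/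
def IsPhiID (φ : ℂ → ℂ) (μ : ProbabilityMeasure ℝ) : Prop :=
  ∃ j m : ℕ, 1 ≤ m ∧ ∃ θ : ℕ → ℝ, (∀ n, 0 < θ n) ∧ Tendsto θ atTop (𝓝 0) ∧
    ∃ κ : ℕ → ProbabilityMeasure ℝ, ∀ t : ℝ,
      Tendsto (fun n => phiPGF φ j m (θ n) (charFun (κ n : Measure ℝ) t)) atTop
        (𝓝 (charFun (μ : Measure ℝ) t))

/-- The Laplace transform `(1 + s) ^ (-1 / k)` of the gamma law with shape `1 / k` and rate `1`,
for `0 ≤ re s`. -/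
def gammaLT (k : ℕ) (s : ℂ) : ℂ :=
  1 / (1 + s) ^ (1 / (k : ℂ))

/-- Gamma-infinitely divisible laws. -/
def IsGammaID (k : ℕ) (μ : ProbabilityMeasure ℝ) : Prop :=
  IsPhiID (gammaLT k) μ

/-- (Classical) infinite divisibility: for each `m ≥ 1` the characteristic function is the `m`-th
power of a characteristic function. -/
def IsInfDiv (η : ProbabilityMeasure ℝ) : Prop :=
  ∀ m : ℕ, 1 ≤ m → ∃ κ : ProbabilityMeasure ℝ, ∀ t : ℝ,
    charFun (η : Measure ℝ) t = charFun (κ : Measure ℝ) t ^ m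

/-- `η` is an infinitely divisible law, with characteristic function `h`, and the characteristic
function of `μ` is `1 / {1 + k (-log h(t))} ^ (1 / k)`. Here `log h` is the distinguished logarithm
`ψ`, the continuous one with `log h(0) = 0`. -/
def HasGammaCF (k : ℕ) (η μ : ProbabilityMeasure ℝ) : Prop :=
  IsInfDiv η ∧ ∃ ψ : ℝ → ℂ, Continuous ψ ∧ ψ 0 = 0 ∧
    (∀ t, Complex.exp (ψ t) = charFun (η : Measure ℝ) t) ∧
    ∀ t, charFun (μ : Measure ℝ) t = 1 / (1 + (k : ℂ) * (-ψ t)) ^ (1 / (k : ℂ))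

/-- `Y`, `ε` and `B` satisfy the generalized autoregressive model with `k` summands and exclusion
probability `p`:  `∑ Y_{i,n} = ∑ ε_{i,n}` with probability `p` (the event `B n = true`) and
`∑ Y_{i,n} = ∑ Y_{i,n-1} + ∑ ε_{i,n}` with probability `1 - p`, for all integers `n > 0`; the model
is stationary, each `Y_{i,n}` has law `μ` and each innovation `ε_{i,n}` has law `ν`. The values of
`ε` and `B` at time `0` play no role. -/
structure IsStationaryAR (k : ℕ) (p : ℝ) (μ ν : ProbabilityMeasure ℝ)
    {Ω : Type} [MeasurableSpace Ω] (P : Measure Ω)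
    (Y ε : Fin k → ℕ → Ω → ℝ) (B : ℕ → Ω → Bool) : Prop where
  isProb : IsProbabilityMeasure P
  measurable_Y : ∀ i n, Measurable (Y i n)
  measurable_ε : ∀ i n, Measurable (ε i n)
  measurable_B : ∀ n, Measurable (B n)
  /-- For each `n`, the variables `Y_{i,n}`, `i = 1, …, k`, are i.i.d. -/
  law_Y : ∀ i n, P.map (Y i n) = (μ : Measure ℝ)
  indep_Y : ∀ n, iIndepFun (fun i => Y i n) P
  /-- All innovations are i.i.d. -/
  law_ε : ∀ i n, P.map (ε i n) = (ν : Measure ℝ)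
  indep_ε : iIndepFun (fun x : Fin k × ℕ => ε x.1 x.2) P
  /-- The deciding variables are i.i.d. Bernoulli, and independent of the innovations. -/
  law_B : ∀ n, P {ω | B n ω = true} = ENNReal.ofReal p
  indep_B : iIndepFun B P
  indep_B_ε : IndepFun (fun ω (n : ℕ) => B n ω) (fun ω (x : Fin k × ℕ) => ε x.1 x.2 ω) P
  /-- What drives the model after time `n` is independent of the model up to time `n`. -/
  indep_past : ∀ n : ℕ,
    IndepFun (fun ω (x : Fin k × Set.Iic n) => Y x.1 x.2 ω)
      (fun ω (m : ℕ) => (B (n + 1 + m) ω, fun i : Fin k => ε i (n + 1 + m) ω)) P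
  /-- The autoregressive equation. -/
  step : ∀ n : ℕ, ∀ᵐ ω ∂P, ∑ i, Y i (n + 1) ω =
    if B (n + 1) ω = true then ∑ i, ε i (n + 1) ω else ∑ i, Y i n ω + ∑ i, ε i (n + 1) ω
  /-- Strict stationarity. -/
  stationary : P.map (fun ω (x : Fin k × ℕ) => Y x.1 (x.2 + 1) ω) =
    P.map (fun ω (x : Fin k × ℕ) => Y x.1 x.2 ω)

/-- For each `n`, there is a stationary model with exclusion probability `p n`, in which the
`Y_{i,·}` have law `μ` and the innovations have law `ν n`. -/
def StationaryAlong (k : ℕ) (p : ℕ → ℝ) (ν : ℕ → ProbabilityMeasure ℝ)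
    (μ : ProbabilityMeasure ℝ) : Prop :=
  ∀ n, ∃ (Ω : Type) (_ : MeasurableSpace Ω) (P : Measure Ω)
    (Y ε : Fin k → ℕ → Ω → ℝ) (B : ℕ → Ω → Bool),
    IsStationaryAR k (p n) μ (ν n) P Y ε B

/-- The same in the limit only: the characteristic function of `μ` is the limit of those of the
Harris(1/p_n, k)-sums of independent innovations with law `ν n`. -/
def LimitStationaryAlong (k : ℕ) (p : ℕ → ℝ) (ν : ℕ → ProbabilityMeasure ℝ)
    (μ : ProbabilityMeasure ℝ) : Prop :=
  ∀ t : ℝ, Tendsto (fun n => harrisPGF (1 / p n) k (charFun (ν n : Measure ℝ) t)) atTop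
    (𝓝 (charFun (μ : Measure ℝ) t))

/-- The characteristic function `h` of `η` is the limiting characteristic function of the classical
sums of `⌊1 / p_n⌋` independent innovations with law `ν n`:
`f_{ε,p_n}(t) ^ ⌊1 / p_n⌋ → h(t)` for all `t`. -/
def InnovationLimit (p : ℕ → ℝ) (ν : ℕ → ProbabilityMeasure ℝ) (η : ProbabilityMeasure ℝ) : Prop :=
  ∀ t : ℝ, Tendsto (fun n => charFun (ν n : Measure ℝ) t ^ ⌊1 / p n⌋₊) atTop
    (𝓝 (charFun (η : Measure ℝ) t))

end

/-! Taking characteristic functions of one autoregressive step gives `f^k = f_ε^k (p + (1 - p)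
f^k)`. Solved for `f^k`, this says that `f^k` is a geometric compound of `f_ε^k`. Extracting `k`-th
roots gives `f = P_{1/p}(f_ε)`: `f` has no zeros, and two continuous functions with the same `k`-th
power that agree at `0` agree everywhere (`IsPreconnected.eqOn_of_pow_eq`). Exact stationarity thus
implies stationarity in the limit.

The reciprocal of a geometric compound is affine in `1 / f_ε^k`, so convergence of the compounds
amounts to `(1/p_n)(f_ε - 1) → ψ`, where `f = (1 - kψ)^(-1/k)` (`LimitStationaryAlong.exists_log`).
Then `f_ε^⌊c/p_n⌋ → exp(cψ)` for every `c ≥ 0`. Lévy's continuity theorem makes these limits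
characteristic functions, so `h = exp ψ` is infinitely divisible. Conversely, `f_ε^⌊1/p_n⌋ → h`
forces `⌊1/p_n⌋(f_ε - 1) → ψ` with the distinguished logarithm (`tendsto_mul_charFun_sub_one`), and
the argument runs backwards.

For existence, the equation forces `f_ε^k = (1 - p k ψ)^(-1)`. The choice `f_ε = (1 - p k ψ)^(-1/k)`
is a characteristic function, being a limit of negative binomial random sums
(`IsInfDiv.exists_charFun_eq_gamma`). The equation then says that the law of a sum of `k`
independent copies of `μ` is invariant under the autoregressive step. The sums therefore form a
stationary Markov chain, and the `Y_{i,n}` are sampled conditionally on their sum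
(`exists_isStationaryAR`). -/

/-! ### Characteristic functions: branches of roots, doubling inequality, Lévy continuity. -/

/-- Two continuous functions on a preconnected set with the same `k`-th power agree once they
agree at a point, as long as one of them has no zeros. -/
theorem IsPreconnected.eqOn_of_pow_eq {S : Set ℝ} (hS : IsPreconnected S) {k : ℕ} (hk : k ≠ 0)
    {u v : ℝ → ℂ} (hu : ContinuousOn u S) (hv : ContinuousOn v S) (hv0 : ∀ t ∈ S, v t ≠ 0)
    (h : ∀ t ∈ S, u t ^ k = v t ^ k) {x : ℝ} (hx : x ∈ S) (hux : u x = v x) :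
    Set.EqOn u v S := by
  intro t ht
  -- The quotient `u / v` is continuous with values in the finite set of `k`-th roots of unity,
  -- hence constant.
  let T : Set ℂ := {z | z ^ k = 1}
  have hT : T.Finite := by
    have : T ⊆ ((Polynomial.nthRoots k (1 : ℂ)).toFinset : Set ℂ) := by
      intro z hz
      have hz' : z ^ k = 1 := hz
      simpa [Polynomial.mem_nthRoots (Nat.pos_of_ne_zero hk)] using hz'
    exact (Finset.finite_toSet _).subset this
  have hmaps : Set.MapsTo (fun s => u s / v s) S T := by
    intro s hs
    change (u s / v s) ^ k = 1
    rw [div_pow, h s hs]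
    exact div_self (pow_ne_zero _ (hv0 s hs))
  have := hS.constant_of_mapsTo hT.isDiscrete (hu.div hv hv0) hmaps ht hx
  replace this : u t / v t = 1 := this.trans (by rw [Pi.div_apply, hux, div_self (hv0 x hx)])
  exact (div_eq_one_iff_eq (hv0 t ht)).1 this

theorem exists_charFun_eq_pow (ν : ProbabilityMeasure ℝ) (m : ℕ) :
    ∃ κ : ProbabilityMeasure ℝ, ∀ t : ℝ, charFun (κ : Measure ℝ) t = charFun (ν : Measure ℝ) t ^ m := by
  induction m with
  | zero => exact ⟨⟨Measure.dirac 0, inferInstance⟩, fun t => by simp⟩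
  | succ m ih =>
    obtain ⟨κ, hκ⟩ := ih
    exact ⟨⟨(κ : Measure ℝ) ∗ (ν : Measure ℝ), inferInstance⟩, fun t => by
      simp [charFun_conv, hκ, pow_succ]⟩

theorem continuous_charFun_coe (ν : ProbabilityMeasure ℝ) : Continuous (charFun (ν : Measure ℝ)) :=
  continuous_charFun

/-- With `e = exp(itx)`, integrate `1 - e² = 2(1 - e) - (1 - e)²`. Since `|e| = 1`, `|1 - e|² = 2
Re(1 - e)`, so the quadratic term is again controlled by `1 - charFun`. This carries bounds near `0`
to all arguments. -/
theorem norm_one_sub_charFun_two_mul_le (ν : ProbabilityMeasure ℝ) (t : ℝ) :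
    ‖1 - charFun (ν : Measure ℝ) (2 * t)‖ ≤ 4 * ‖1 - charFun (ν : Measure ℝ) t‖ := by
  set e : ℝ → ℂ := fun x => Complex.exp (t * x * Complex.I) with he
  have hn : ∀ x, ‖e x‖ = 1 := fun x => by
    rw [he]; simpa using Complex.norm_exp_ofReal_mul_I (t * x)
  have hec : Continuous e := by fun_prop
  have hi : Integrable e (ν : Measure ℝ) :=
    Integrable.of_bound hec.aestronglyMeasurable 1 (ae_of_all _ fun x => (hn x).le)
  have hi1 : Integrable (fun x => 1 - e x) (ν : Measure ℝ) := (integrable_const _).sub hi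
  have hi2 : Integrable (fun x => (1 - e x) ^ 2) (ν : Measure ℝ) := by
    refine Integrable.of_bound (by fun_prop) (2 ^ 2) (ae_of_all _ fun x => ?_)
    rw [norm_pow]
    gcongr
    calc _ ≤ ‖(1 : ℂ)‖ + ‖e x‖ := norm_sub_le _ _
      _ = 2 := by rw [hn]; norm_num
  have h1 : ∫ x, (1 - e x) ∂(ν : Measure ℝ) = 1 - charFun (ν : Measure ℝ) t := by
    rw [integral_sub (integrable_const _) hi, charFun_apply_real]; simp [he]
  have h2 : 1 - charFun (ν : Measure ℝ) (2 * t)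
      = 2 * (1 - charFun (ν : Measure ℝ) t) - ∫ x, (1 - e x) ^ 2 ∂(ν : Measure ℝ) := by
    rw [← h1, ← integral_const_mul, ← integral_sub (hi1.const_mul _) hi2, charFun_apply_real]
    have h3 : ∀ x : ℝ, Complex.exp (((2 * t : ℝ) : ℂ) * x * Complex.I) = e x ^ 2 := fun x => by
      rw [he, ← Complex.exp_nat_mul]; push_cast; ring_nf
    have hi3 : Integrable (fun x => e x ^ 2) (ν : Measure ℝ) :=
      Integrable.of_bound (by fun_prop) 1 (ae_of_all _ fun x => by simp [hn x])
    simp_rw [h3]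
    have : (1 : ℂ) = ∫ _, (1 : ℂ) ∂(ν : Measure ℝ) := by simp
    nth_rw 1 [this]
    rw [← integral_sub (integrable_const _) hi3]
    congr 1; ext x; ring
  have h4 : ‖∫ x, (1 - e x) ^ 2 ∂(ν : Measure ℝ)‖ ≤ 2 * ‖1 - charFun (ν : Measure ℝ) t‖ := by
    have hsq : ∀ x, ‖(1 - e x) ^ 2‖ = 2 * (1 - e x).re := fun x => by
      have := hn x
      rw [norm_pow, ← Complex.normSq_eq_norm_sq, Complex.normSq_apply]
      have h5 : (e x).re * (e x).re + (e x).im * (e x).im = 1 := by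
        rw [← Complex.normSq_apply, Complex.normSq_eq_norm_sq, this]; norm_num
      simp only [Complex.sub_re, Complex.one_re, Complex.sub_im, Complex.one_im]
      nlinarith
    calc _ ≤ ∫ x, ‖(1 - e x) ^ 2‖ ∂(ν : Measure ℝ) := norm_integral_le_integral_norm _
      _ = 2 * (∫ x, (1 - e x) ∂(ν : Measure ℝ)).re := by
        simp_rw [hsq]
        rw [integral_const_mul]
        congr 1
        exact integral_re hi1
      _ ≤ _ := by rw [h1]; gcongr; exact Complex.re_le_norm _
  rw [h2]
  calc _ ≤ ‖2 * (1 - charFun (ν : Measure ℝ) t)‖ + _ := norm_sub_le _ _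
    _ ≤ 2 * ‖1 - charFun (ν : Measure ℝ) t‖ + 2 * ‖1 - charFun (ν : Measure ℝ) t‖ := by
      gcongr; simp
    _ = _ := by ring

theorem isTightMeasureSet_of_tendsto {μ : ℕ → ProbabilityMeasure ℝ} {f : ℝ → ℂ}
    (hf : ContinuousAt f 0)
    (h : ∀ t : ℝ, Tendsto (fun n => charFun (μ n : Measure ℝ) t) atTop (𝓝 (f t))) :
    IsTightMeasureSet (Set.range fun n => (μ n : Measure ℝ)) :=
  isTightMeasureSet_of_tendsto_charFun hf h

/-- Lévy's continuity theorem: a pointwise limit of characteristic functions that is continuous at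
`0` is a characteristic function. -/
theorem exists_charFun_eq_of_tendsto {μ : ℕ → ProbabilityMeasure ℝ} {f : ℝ → ℂ}
    (hf : ContinuousAt f 0)
    (h : ∀ t : ℝ, Tendsto (fun n => charFun (μ n : Measure ℝ) t) atTop (𝓝 (f t))) :
    ∃ η : ProbabilityMeasure ℝ, ∀ t : ℝ, charFun (η : Measure ℝ) t = f t := by
  have hc : IsCompact (closure (Set.range μ)) := by
    apply isCompact_closure_of_isTightMeasureSet
    convert isTightMeasureSet_of_tendsto hf h
    ext; simp
  -- By tightness the laws converge along an ultrafilter finer than `atTop`, and pointwise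
  -- convergence identifies the characteristic function of the limit. No subsequence is needed.
  let U : Ultrafilter ℕ := Ultrafilter.of atTop
  have hU : (U : Filter ℕ) ≤ atTop := Ultrafilter.of_le _
  obtain ⟨η, -, hη⟩ := hc.ultrafilter_le_nhds (U.map μ)
    (.trans (by simp) (monotone_principal subset_closure))
  have hη' : Tendsto μ U (𝓝 η) := hη
  refine ⟨η, fun t => tendsto_nhds_unique (l := (U : Filter ℕ)) ?_ ((h t).mono_left hU)⟩
  rw [ProbabilityMeasure.tendsto_iff_forall_integral_rclike_tendsto ℂ] at hη'
  simp_rw [charFun_eq_integral_innerProbChar]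
  exact hη' (BoundedContinuousFunction.innerProbChar t)

/-- Tightness gives one `R` with mass below `ε/4` outside `[-R, R]` for all the laws. Inside, the
integrands differ by at most `|s - t| R`; outside, by at most `2`. -/
theorem uniformEquicontinuous_charFun {μ : ℕ → ProbabilityMeasure ℝ}
    (h : IsTightMeasureSet (Set.range fun n => (μ n : Measure ℝ))) :
    UniformEquicontinuous (fun n => charFun (μ n : Measure ℝ)) := by
  rw [Metric.uniformEquicontinuous_iff]
  intro ε hε
  have h1 := (tendsto_measure_norm_gt_of_isTightMeasureSet h).eventually
    (gt_mem_nhds (ENNReal.ofReal_pos.2 (by positivity : 0 < ε / 4)))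
  obtain ⟨R, hR, hR0⟩ := (h1.and (eventually_gt_atTop 0)).exists
  refine ⟨ε / (2 * R), by positivity, fun s t hst n => ?_⟩
  have hm : (μ n : Measure ℝ).real {x | R < ‖x‖} < ε / 4 := by
    have : (μ n : Measure ℝ) {x | R < ‖x‖} < ENNReal.ofReal (ε / 4) :=
      lt_of_le_of_lt (le_iSup₂ (f := fun (ρ : Measure ℝ) _ => ρ {x | R < ‖x‖}) _ ⟨n, rfl⟩) hR
    exact (ENNReal.lt_ofReal_iff_toReal_lt (measure_ne_top _ _)).1 this
  have hms : MeasurableSet {x : ℝ | R < ‖x‖} := (isOpen_lt continuous_const continuous_norm).measurableSet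
  have hn : ∀ r x : ℝ, ‖Complex.exp (r * x * Complex.I)‖ = 1 := fun r x => by
    simpa using Complex.norm_exp_ofReal_mul_I (r * x)
  have hi : ∀ r : ℝ, Integrable (fun x : ℝ => Complex.exp (r * x * Complex.I)) (μ n : Measure ℝ) :=
    fun r => Integrable.of_bound (by fun_prop) 1 (ae_of_all _ fun x => (hn r x).le)
  have hb : ∀ x : ℝ, ‖Complex.exp (s * x * Complex.I) - Complex.exp (t * x * Complex.I)‖
      ≤ dist s t * R + {x | R < ‖x‖}.indicator (fun _ => (2 : ℝ)) x := by
    intro x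
    by_cases hx : R < ‖x‖
    · rw [Set.indicator_of_mem (by exact hx)]
      calc _ ≤ ‖Complex.exp (s * x * Complex.I)‖ + ‖Complex.exp (t * x * Complex.I)‖ :=
            norm_sub_le _ _
        _ = 2 := by rw [hn, hn]; norm_num
        _ ≤ _ := by have : 0 ≤ dist s t * R := by positivity
                    linarith
    · rw [Set.indicator_of_notMem (by exact hx), add_zero]
      have h2 : Complex.exp (s * x * Complex.I) - Complex.exp (t * x * Complex.I)
          = Complex.exp (t * x * Complex.I) *
            (Complex.exp (Complex.I * ((s - t) * x : ℝ)) - 1) := by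
        rw [mul_sub, ← Complex.exp_add]; push_cast; ring_nf
      rw [h2, norm_mul, hn, one_mul]
      refine (Real.norm_exp_I_mul_ofReal_sub_one_le).trans ?_
      rw [norm_mul, Real.dist_eq, Real.norm_eq_abs]
      gcongr
      exact not_lt.1 hx
  rw [dist_eq_norm, charFun_apply_real, charFun_apply_real, ← integral_sub (hi s) (hi t)]
  have hind : Integrable ({x : ℝ | R < ‖x‖}.indicator (fun _ => (2 : ℝ))) (μ n : Measure ℝ) :=
    (integrable_const _).indicator hms
  calc _ ≤ ∫ x, (dist s t * R + {x | R < ‖x‖}.indicator (fun _ => (2 : ℝ)) x) ∂(μ n : Measure ℝ) :=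
        norm_integral_le_of_norm_le ((integrable_const _).add hind) (ae_of_all _ hb)
    _ = dist s t * R + (μ n : Measure ℝ).real {x | R < ‖x‖} * 2 := by
        rw [integral_add (integrable_const _) hind, integral_indicator hms]; simp
    _ < ε / (2 * R) * R + ε / 4 * 2 := by gcongr
    _ = ε := by field_simp; norm_num

/-- Pointwise convergence to a function continuous at `0` of characteristic functions is locally
uniform. -/
theorem tendstoUniformlyOn_charFun {μ : ℕ → ProbabilityMeasure ℝ} {f : ℝ → ℂ}
    (hf : ContinuousAt f 0)
    (h : ∀ t : ℝ, Tendsto (fun n => charFun (μ n : Measure ℝ) t) atTop (𝓝 (f t)))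
    {K : Set ℝ} (hK : IsCompact K) :
    TendstoUniformlyOn (fun n => charFun (μ n : Measure ℝ)) f atTop K := by
  have he := uniformEquicontinuous_charFun (isTightMeasureSet_of_tendsto hf h)
  have := (EquicontinuousOn.tendsto_uniformOnFun_iff_pi (𝔖 := {K : Set ℝ | IsCompact K})
    (fun _ hK => hK) (Set.sUnion_eq_univ_iff.2 fun x => ⟨{x}, isCompact_singleton, rfl⟩)
    (fun K _ => he.equicontinuous.equicontinuousOn K) atTop f).2 (tendsto_pi_nhds.2 h)
  exact (UniformOnFun.tendsto_iff_tendstoUniformlyOn.1 this) K hK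

/-! ### Passing between `N (z - 1)` and `z ^ N`. -/

/-- Factor `f z - f a = (z - a) · dslope f a z`; the second factor is continuous at `a` with value
`f'`. It is applied below to `log`, `exp` and `z ^ k`. -/
theorem HasDerivAt.tendsto_mul_sub {f : ℂ → ℂ} {f' a w : ℂ} (hf : HasDerivAt f f' a)
    {c z : ℕ → ℂ} (hz : Tendsto z atTop (𝓝 a))
    (h : Tendsto (fun n => c n * (z n - a)) atTop (𝓝 w)) :
    Tendsto (fun n => c n * (f (z n) - f a)) atTop (𝓝 (w * f')) := by
  have h1 : ContinuousAt (dslope f a) a := continuousAt_dslope_same.2 hf.differentiableAt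
  have h2 := h.mul (h1.tendsto.comp hz)
  rw [dslope_same, hf.deriv] at h2
  refine h2.congr fun n => ?_
  rw [Function.comp_apply, mul_assoc, ← smul_eq_mul (z n - a), sub_smul_dslope]

theorem tendsto_of_tendsto_mul_sub {c : ℕ → ℝ} (hc : Tendsto c atTop atTop) {z : ℕ → ℂ} {a w : ℂ}
    (h : Tendsto (fun n => (c n : ℂ) * (z n - a)) atTop (𝓝 w)) : Tendsto z atTop (𝓝 a) := by
  have h1 : Tendsto (fun n => ((c n)⁻¹ : ℝ)) atTop (𝓝 0) := tendsto_inv_atTop_zero.comp hc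
  have h2 := ((Complex.continuous_ofReal.tendsto 0).comp h1).mul h
  simp only [Complex.ofReal_zero, zero_mul] at h2
  rw [← tendsto_sub_nhds_zero_iff]
  refine h2.congr' ?_
  filter_upwards [hc.eventually_gt_atTop 0] with n hn
  have : (c n : ℂ) ≠ 0 := by exact_mod_cast hn.ne'
  simp only [Function.comp_apply, Complex.ofReal_inv]
  rw [inv_mul_cancel_left₀ this]

theorem tendsto_pow_exp_of_tendsto {N : ℕ → ℕ} {z : ℕ → ℂ} {w : ℂ}
    (hz : Tendsto z atTop (𝓝 1))
    (h : Tendsto (fun n => (N n : ℂ) * (z n - 1)) atTop (𝓝 w)) :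
    Tendsto (fun n => z n ^ N n) atTop (𝓝 (Complex.exp w)) := by
  have h1 := (Complex.hasDerivAt_log Complex.one_mem_slitPlane).tendsto_mul_sub hz h
  simp only [Complex.log_one, sub_zero, inv_one, mul_one] at h1
  refine ((Complex.continuous_exp.tendsto w).comp h1).congr' ?_
  filter_upwards [hz.eventually_ne one_ne_zero] with n hn
  rw [Function.comp_apply, Complex.exp_nat_mul, Complex.exp_log hn]

theorem tendsto_mul_exp_sub_one {N : ℕ → ℕ} (hN : Tendsto N atTop atTop) {L : ℕ → ℂ} {w : ℂ}
    (h : Tendsto (fun n => (N n : ℂ) * L n) atTop (𝓝 w)) :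
    Tendsto (fun n => (N n : ℂ) * (Complex.exp (L n) - 1)) atTop (𝓝 w) := by
  have hL : Tendsto L atTop (𝓝 0) :=
    tendsto_of_tendsto_mul_sub (tendsto_natCast_atTop_atTop.comp hN) (by simpa using h)
  simpa using (Complex.hasDerivAt_exp 0).tendsto_mul_sub hL (by simpa using h)

/-- If `f_n ^ N_n` converges to the characteristic function `exp ψ`, then `N_n (f_n - 1)` converges
to the distinguished logarithm `ψ`. -/
theorem tendsto_mul_charFun_sub_one {ν : ℕ → ProbabilityMeasure ℝ} {N : ℕ → ℕ}
    (hN : Tendsto N atTop atTop) {ψ : ℝ → ℂ} (hψ : Continuous ψ) (hψ0 : ψ 0 = 0)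
    (h : ∀ t, Tendsto (fun n => charFun (ν n : Measure ℝ) t ^ N n) atTop (𝓝 (Complex.exp (ψ t))))
    (t : ℝ) :
    Tendsto (fun n => (N n : ℂ) * (charFun (ν n : Measure ℝ) t - 1)) atTop (𝓝 (ψ t)) := by
  choose κ hκ using fun n => exists_charFun_eq_pow (ν n) (N n)
  have hκl : ∀ t, Tendsto (fun n => charFun (κ n : Measure ℝ) t) atTop (𝓝 (Complex.exp (ψ t))) :=
    fun t => by simpa only [hκ] using h t
  have hK : IsCompact (Set.uIcc 0 t) := isCompact_uIcc
  have hexp : Continuous fun s => Complex.exp (ψ s) := Complex.continuous_exp.comp hψ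
  have hu := tendstoUniformlyOn_charFun hexp.continuousAt hκl hK
  -- As `|exp(-ψ)| ≤ C` on the segment, uniform closeness `1/(C+1)` puts `v` below within distance
  -- `1` of `1`, where the principal logarithm is continuous.
  obtain ⟨C, hC⟩ := hK.exists_bound_of_continuousOn
    (f := fun s => Complex.exp (-ψ s)) (by fun_prop)
  have hC0 : 0 ≤ C := (norm_nonneg _).trans (hC 0 Set.left_mem_uIcc)
  have hev := Metric.tendstoUniformlyOn_iff.1 hu (1 / (C + 1)) (by positivity)
  set v : ℕ → ℝ → ℂ := fun n s => Complex.exp (-ψ s) * charFun (κ n : Measure ℝ) s with hv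
  -- Both sides are continuous `N`-th roots of `f_n ^ N` on the segment from `0` to `t` and equal
  -- `1` at `0`. This selects the right branch of the root.
  have hroot : ∀ᶠ n in atTop, charFun (ν n : Measure ℝ) t
      = Complex.exp ((ψ t + Complex.log (v n t)) / N n) := by
    filter_upwards [hev, hN.eventually_ge_atTop 1] with n hn hN1
    have hN0 : (N n : ℂ) ≠ 0 := by exact_mod_cast (by omega : N n ≠ 0)
    have hsl : ∀ s ∈ Set.uIcc 0 t, v n s ∈ Complex.slitPlane := by
      intro s hs
      have h1 : v n s = 1 + Complex.exp (-ψ s) *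
          (charFun (κ n : Measure ℝ) s - Complex.exp (ψ s)) := by
        rw [mul_sub, ← Complex.exp_add]; simp [hv]
      rw [h1]
      apply Complex.mem_slitPlane_of_norm_lt_one
      have h2 := hn s hs
      rw [dist_comm, dist_eq_norm] at h2
      rw [norm_mul]
      calc _ ≤ C * (1 / (C + 1)) := by gcongr; exact hC s hs
        _ < 1 := by rw [mul_one_div, div_lt_one (by positivity)]; linarith
    have hvc : Continuous (v n) :=
      (Complex.continuous_exp.comp hψ.neg).mul (continuous_charFun_coe _)
    refine isPreconnected_uIcc.eqOn_of_pow_eq (S := Set.uIcc 0 t) (k := N n) (by omega)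
      (u := charFun (ν n : Measure ℝ))
      (v := fun s => Complex.exp ((ψ s + Complex.log (v n s)) / N n))
      (continuous_charFun_coe _).continuousOn ?_ (fun _ _ => Complex.exp_ne_zero _) ?_
      Set.left_mem_uIcc ?_ Set.right_mem_uIcc
    · exact Complex.continuous_exp.comp_continuousOn
        ((hψ.continuousOn.add (hvc.continuousOn.clog hsl)).div_const _)
    · intro s hs
      rw [← Complex.exp_nat_mul, mul_div_cancel₀ _ hN0, Complex.exp_add,
        Complex.exp_log (Complex.slitPlane_ne_zero (hsl s hs)), ← hκ]
      simp only [hv]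
      rw [← mul_assoc, ← Complex.exp_add]; simp
    · simp [hv, hψ0]
  have hvl : Tendsto (fun n => v n t) atTop (𝓝 1) := by
    have := (hκl t).const_mul (Complex.exp (-ψ t))
    rwa [← Complex.exp_add, neg_add_cancel, Complex.exp_zero] at this
  have hlog : Tendsto (fun n => Complex.log (v n t)) atTop (𝓝 0) := by
    simpa using hvl.clog Complex.one_mem_slitPlane
  have := tendsto_mul_exp_sub_one hN (L := fun n => (ψ t + Complex.log (v n t)) / N n) (w := ψ t) ?_
  · refine this.congr' ?_
    filter_upwards [hroot] with n hn
    rw [hn]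
  · have h3 : Tendsto (fun n => ψ t + Complex.log (v n t)) atTop (𝓝 (ψ t)) := by
      simpa using hlog.const_add (ψ t)
    refine h3.congr' ?_
    filter_upwards [hN.eventually_ge_atTop 1] with n hN1
    have hN0 : (N n : ℂ) ≠ 0 := by exact_mod_cast (by omega : N n ≠ 0)
    rw [mul_div_cancel₀ _ hN0]

/-! ### Harris generating functions and limits of geometric compounds. -/

/-- Keeps the denominators nonzero and away from the branch cut, so that principal roots of them are
continuous. -/
theorem one_le_re_harris {a : ℝ} (ha : 1 ≤ a) {z : ℂ} (hz : ‖z‖ ≤ 1) :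
    1 ≤ ((a : ℂ) - ((a : ℂ) - 1) * z).re := by
  have h1 : z.re ≤ 1 := (Complex.re_le_norm z).trans hz
  have : ((a : ℂ) - ((a : ℂ) - 1) * z).re = a - (a - 1) * z.re := by simp
  rw [this]; nlinarith

theorem harrisPGF_pow {k : ℕ} (hk : k ≠ 0) (a : ℝ) (s : ℂ) :
    harrisPGF a k s ^ k = s ^ k / ((a : ℂ) - ((a : ℂ) - 1) * s ^ k) := by
  rw [harrisPGF, div_pow, one_div, Complex.cpow_nat_inv_pow _ hk]

theorem norm_charFun_le_one_coe (ν : ProbabilityMeasure ℝ) (t : ℝ) :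
    ‖charFun (ν : Measure ℝ) t‖ ≤ 1 := norm_charFun_le_one t

/-- The reciprocal of the compound is `1 + a (1/z - 1)`, so `a (1/z - 1) → 1/g - 1`. As `a → ∞` this
forces `z → 1`, and multiplying by `z` finishes. -/
theorem tendsto_mul_one_sub_of_tendsto_div {a : ℕ → ℝ} (ha : Tendsto a atTop atTop) {z : ℕ → ℂ}
    {g : ℂ} (h : Tendsto (fun n => z n / ((a n : ℂ) - ((a n : ℂ) - 1) * z n)) atTop (𝓝 g))
    (hg : g ≠ 0) :
    Tendsto (fun n => (a n : ℂ) * (1 - z n)) atTop (𝓝 (1 / g - 1)) := by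
  have h1 : Tendsto (fun n => (a n : ℂ) * ((z n)⁻¹ - 1)) atTop (𝓝 (1 / g - 1)) := by
    have := (h.inv₀ hg).sub_const 1
    rw [one_div]
    refine this.congr' ?_
    filter_upwards [h.eventually_ne hg] with n hn
    have hz : z n ≠ 0 := fun h0 => hn (by simp [h0])
    rw [inv_div]; field_simp; ring
  have h2 : Tendsto z atTop (𝓝 1) := by
    simpa using (tendsto_of_tendsto_mul_sub ha h1).inv₀ one_ne_zero
  have h3 := h2.mul h1
  rw [one_mul] at h3
  refine h3.congr' ?_
  filter_upwards [h2.eventually_ne one_ne_zero] with n hn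
  field_simp

/-- A continuous limit of geometric compounds has no zeros. -/
theorem ne_zero_of_tendsto_charFun_div {κ : ℕ → ProbabilityMeasure ℝ} {a : ℕ → ℝ}
    (ha : Tendsto a atTop atTop) {g : ℝ → ℂ} (hg : Continuous g) (hg0 : g 0 = 1)
    (h : ∀ t, Tendsto (fun n => charFun (κ n : Measure ℝ) t /
      ((a n : ℂ) - ((a n : ℂ) - 1) * charFun (κ n : Measure ℝ) t)) atTop (𝓝 (g t))) (t : ℝ) :
    g t ≠ 0 := by
  -- Boundedness of `a_n |1 - κ_n|` holds wherever `g ≠ 0`, in particular near `0`. It survives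
  -- doubling of the argument, hence holds everywhere.
  set B : ℝ → Prop := fun t => ∃ C : ℝ, ∀ᶠ n in atTop,
    a n * ‖1 - charFun (κ n : Measure ℝ) t‖ ≤ C with hB
  have hBg : ∀ t, g t ≠ 0 → B t := by
    intro t ht
    have h1 := (tendsto_mul_one_sub_of_tendsto_div ha (h t) ht).norm
    refine ⟨‖1 / g t - 1‖ + 1, ?_⟩
    filter_upwards [h1.eventually_le_const (lt_add_one _), ha.eventually_ge_atTop 0] with n hn hn0
    rwa [norm_mul, Complex.norm_real, Real.norm_of_nonneg hn0] at hn
  have hdouble : ∀ t, B t → B (2 * t) := by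
    rintro t ⟨C, hC⟩
    refine ⟨4 * C, ?_⟩
    filter_upwards [hC, ha.eventually_ge_atTop 0] with n hn hn0
    calc _ ≤ a n * (4 * ‖1 - charFun (κ n : Measure ℝ) t‖) := by
          gcongr; exact norm_one_sub_charFun_two_mul_le _ _
      _ ≤ _ := by linarith
  have hpow : ∀ m : ℕ, ∀ t, B t → B (2 ^ m * t) := by
    intro m
    induction m with
    | zero => intro t ht; simpa using ht
    | succ m ih => intro t ht; rw [pow_succ', mul_assoc]; exact hdouble _ (ih t ht)
  have hall : B t := by
    have h1 : Tendsto (fun m : ℕ => t / 2 ^ m) atTop (𝓝 0) :=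
      tendsto_const_nhds.div_atTop (tendsto_pow_atTop_atTop_of_one_lt one_lt_two)
    have h2 : ∀ᶠ m : ℕ in atTop, g (t / 2 ^ m) ≠ 0 := by
      refine ((hg.tendsto 0).comp h1).eventually_ne ?_
      rw [hg0]; exact one_ne_zero
    obtain ⟨m, hm⟩ := h2.exists
    have := hpow m _ (hBg _ hm)
    rwa [mul_div_cancel₀ _ (by positivity)] at this
  obtain ⟨C, hC⟩ := hall
  intro h0
  have hC0 : 0 ≤ C := by
    obtain ⟨n, hn, hn0⟩ := (hC.and (ha.eventually_ge_atTop 0)).exists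
    exact le_trans (by positivity) hn
  -- Once `a_n ≥ 2C`, `|1 - z| ≤ 1/2` gives `|z| ≥ 1/2`, and the denominator `1 + (a_n - 1)(1 - z)`
  -- has norm at most `1 + C`. The compounds therefore cannot tend to `0`.
  have hlow : ∀ᶠ n in atTop, (1 / 2) / (1 + C) ≤ ‖charFun (κ n : Measure ℝ) t /
      ((a n : ℂ) - ((a n : ℂ) - 1) * charFun (κ n : Measure ℝ) t)‖ := by
    filter_upwards [hC, ha.eventually_ge_atTop 1, ha.eventually_ge_atTop (2 * C)] with n hn hn1 hn2
    set z := charFun (κ n : Measure ℝ) t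
    have hz : 1 / 2 ≤ ‖z‖ := by
      have h3 : ‖1 - z‖ ≤ 1 / 2 := by
        by_contra! hlt
        nlinarith
      have h4 : ‖(1 : ℂ)‖ ≤ ‖1 - z‖ + ‖z‖ := by simpa using norm_add_le (1 - z) z
      rw [norm_one] at h4; linarith
    have hre := one_le_re_harris hn1 (norm_charFun_le_one_coe (κ n) t)
    have hpos : 0 < ‖(a n : ℂ) - ((a n : ℂ) - 1) * z‖ :=
      lt_of_lt_of_le (by linarith) (Complex.re_le_norm _)
    rw [norm_div]
    refine div_le_div₀ (norm_nonneg _) hz hpos ?_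
    have : (a n : ℂ) - ((a n : ℂ) - 1) * z = 1 + ((a n - 1 : ℝ) : ℂ) * (1 - z) := by
      push_cast; ring
    rw [this]
    refine (norm_add_le _ _).trans ?_
    rw [norm_one, norm_mul, Complex.norm_real, Real.norm_of_nonneg (by linarith)]
    nlinarith [norm_nonneg (1 - z)]
  have := ge_of_tendsto (h t).norm hlow
  rw [h0, norm_zero] at this
  have : 0 < (1 / 2) / (1 + C) := by positivity
  linarith

theorem continuousAt_cpow_of_one_le_re {z : ℂ} (hz : 1 ≤ z.re) (c : ℂ) :
    ContinuousAt (fun w : ℂ => w ^ c) z :=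
  continuousAt_cpow_const (Or.inl (by linarith))

theorem one_le_re_one_add_mul_neg_of_exp_eq_charFun {k : ℕ} {η : ProbabilityMeasure ℝ} {ψ : ℂ} {t : ℝ}
    (h : Complex.exp ψ = charFun (η : Measure ℝ) t) : 1 ≤ (1 + (k : ℂ) * (-ψ)).re := by
  have h1 : ‖Complex.exp ψ‖ ≤ 1 := h ▸ norm_charFun_le_one_coe η t
  rw [Complex.norm_exp, Real.exp_le_one_iff] at h1
  have : (1 + (k : ℂ) * (-ψ)).re = 1 + k * (-ψ.re) := by simp
  rw [this]
  have : (0 : ℝ) ≤ k := k.cast_nonneg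
  nlinarith

/-- `⌊c a⌋ / a → c`. The factor `c = 1/m` later produces the `m`-th root of the limit law. -/
theorem tendsto_nat_floor_mul_sub_one {a : ℕ → ℝ} (ha : Tendsto a atTop atTop) {c : ℝ} (hc : 0 ≤ c)
    {z : ℕ → ℂ} {w : ℂ} (h : Tendsto (fun n => (a n : ℂ) * (z n - 1)) atTop (𝓝 w)) :
    Tendsto (fun n => ((⌊c * a n⌋₊ : ℕ) : ℂ) * (z n - 1)) atTop (𝓝 (c * w)) := by
  have h1 := (tendsto_nat_floor_mul_div_atTop hc).comp ha
  have h2 := ((Complex.continuous_ofReal.tendsto c).comp h1).mul h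
  refine h2.congr' ?_
  filter_upwards [ha.eventually_gt_atTop 0] with n hn
  have : (a n : ℂ) ≠ 0 := by exact_mod_cast hn.ne'
  simp only [Function.comp_apply, Complex.ofReal_div, Complex.ofReal_natCast]
  field_simp

/-- Analytic core of the passage to the limit. -/
theorem LimitStationaryAlong.exists_log {k : ℕ} (hk : 1 ≤ k) {μ : ProbabilityMeasure ℝ} {p : ℕ → ℝ}
    (ha : Tendsto (fun n => 1 / p n) atTop atTop)
    {ν : ℕ → ProbabilityMeasure ℝ} (h : LimitStationaryAlong k p ν μ) :
    ∃ ψ : ℝ → ℂ, Continuous ψ ∧ ψ 0 = 0 ∧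
      (∀ t, Tendsto (fun n => ((1 / p n : ℝ) : ℂ) * (charFun (ν n : Measure ℝ) t - 1)) atTop
        (𝓝 (ψ t))) ∧
      ∀ t, charFun (μ : Measure ℝ) t = 1 / (1 + (k : ℂ) * (-ψ t)) ^ (1 / (k : ℂ)) := by
  have hk0 : k ≠ 0 := by omega
  have hkc : (k : ℂ) ≠ 0 := by exact_mod_cast hk0
  set f := charFun (μ : Measure ℝ) with hf
  have hfc : Continuous f := continuous_charFun_coe μ
  -- On `k`-th powers the Harris compound becomes a geometric compound of the law with
  -- characteristic function `f_ε^k`.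
  choose κ hκ using fun n => exists_charFun_eq_pow (ν n) k
  have hg : ∀ t, Tendsto (fun n => charFun (κ n : Measure ℝ) t /
      (((1 / p n : ℝ) : ℂ) - (((1 / p n : ℝ) : ℂ) - 1) * charFun (κ n : Measure ℝ) t)) atTop
      (𝓝 (f t ^ k)) := by
    intro t
    simp_rw [hκ, ← harrisPGF_pow hk0]
    exact (h t).pow k
  have hgc : Continuous fun t => f t ^ k := hfc.pow k
  have hne := ne_zero_of_tendsto_charFun_div ha hgc (by simp [hf]) hg
  have hlim : ∀ t, Tendsto (fun n => ((1 / p n : ℝ) : ℂ) * (1 - charFun (κ n : Measure ℝ) t)) atTop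
      (𝓝 (1 / f t ^ k - 1)) :=
    fun t => tendsto_mul_one_sub_of_tendsto_div ha (hg t) (hne t)
  have hκ1 : ∀ t, Tendsto (fun n => charFun (κ n : Measure ℝ) t) atTop (𝓝 1) := by
    intro t
    refine tendsto_of_tendsto_mul_sub ha ((hlim t).neg.congr fun n => ?_)
    ring
  have hD : ∀ t, Tendsto (fun n => ((1 / p n : ℝ) : ℂ) -
      (((1 / p n : ℝ) : ℂ) - 1) * charFun (κ n : Measure ℝ) t) atTop (𝓝 (1 / f t ^ k)) := by
    intro t
    have := (hlim t).add (hκ1 t)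
    rw [sub_add_cancel] at this
    exact this.congr fun n => by ring
  have hre : ∀ t, 1 ≤ (1 / f t ^ k).re := by
    intro t
    refine ge_of_tendsto ((Complex.continuous_re.tendsto _).comp (hD t)) ?_
    filter_upwards [ha.eventually_ge_atTop 1] with n hn
    exact one_le_re_harris hn (norm_charFun_le_one_coe _ _)
  -- `u` is continuous, `u^k = 1` and `u(0) = 1`, so `u = 1`: `f` is the reciprocal of the principal
  -- root of `1 / f^k`.
  set u : ℝ → ℂ := fun t => f t * (1 / f t ^ k) ^ (1 / (k : ℂ)) with hu
  have huc : Continuous u := by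
    refine hfc.mul (continuous_iff_continuousAt.2 fun t => ?_)
    exact (continuousAt_cpow_of_one_le_re (hre t) _).comp
      (f := fun t => 1 / f t ^ k) ((continuous_const.div hgc hne).continuousAt)
  have hu1 : ∀ t, u t = 1 := fun t =>
    isPreconnected_univ.eqOn_of_pow_eq (S := Set.univ) hk0 (u := u) (v := fun _ => 1)
      huc.continuousOn continuousOn_const (by simp)
      (fun t _ => by
        rw [hu, mul_pow, one_div (k : ℂ), Complex.cpow_nat_inv_pow _ hk0, one_pow,
          mul_one_div, div_self (hne t)])
      (Set.mem_univ 0) (by simp [hu, hf]) (Set.mem_univ t)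
  -- `f_ε^k → 1` would leave the branch of `f_ε` open. Instead `f_ε` is the Harris compound times
  -- the root of its denominator, which tends to `u = 1`.
  have hν1 : ∀ t, Tendsto (fun n => charFun (ν n : Measure ℝ) t) atTop (𝓝 1) := by
    intro t
    have h1 := (h t).mul (((continuousAt_cpow_of_one_le_re (hre t) (1 / (k : ℂ))).tendsto).comp
      (hD t))
    rw [show f t * (1 / f t ^ k) ^ (1 / (k : ℂ)) = 1 from hu1 t] at h1
    refine h1.congr' ?_
    filter_upwards [ha.eventually_ge_atTop 1] with n hn
    rw [Function.comp_apply, harrisPGF, ← hκ]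
    have h2 := one_le_re_harris hn (norm_charFun_le_one_coe (κ n) t)
    refine div_mul_cancel₀ _ fun h0 => ?_
    rw [Complex.cpow_eq_zero_iff] at h0
    rw [h0.1] at h2
    norm_num at h2
  refine ⟨fun t => (1 - 1 / f t ^ k) / k,
    (continuous_const.sub (continuous_const.div hgc hne)).div_const _, by simp [hf], fun t => ?_,
    fun t => ?_⟩
  -- Since `z^k - 1 = (z - 1) ∑ z^i` and the sum tends to `k`, the limit for `f_ε^k` descends to
  -- `f_ε`.
  · have hS : Tendsto (fun n => ∑ i ∈ Finset.range k, charFun (ν n : Measure ℝ) t ^ i) atTop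
        (𝓝 (k : ℂ)) := by
      have := tendsto_finsetSum (Finset.range k) fun i _ => (hν1 t).pow i
      simpa using this
    have h1 := ((hlim t).neg).div hS hkc
    rw [neg_sub] at h1
    refine h1.congr' ?_
    filter_upwards [hS.eventually_ne hkc] with n hn
    have h2 := mul_geom_sum (charFun (ν n : Measure ℝ) t) k
    simp only [Pi.div_apply]
    rw [div_eq_iff hn, mul_assoc, h2, hκ]
    ring
  · have h1 : 1 + (k : ℂ) * (-((1 - 1 / f t ^ k) / k)) = 1 / f t ^ k := by
      field_simp; ring
    rw [h1, eq_div_iff]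
    · exact hu1 t
    · intro h0
      have h2 : f t * (1 / f t ^ k) ^ (1 / (k : ℂ)) = 1 := hu1 t
      rw [h0, mul_zero] at h2
      exact zero_ne_one h2

/-! ### Limit stationarity, gamma infinite divisibility and the innovation limit. -/

theorem tendsto_one_div_atTop {p : ℕ → ℝ} (hp : ∀ n, 0 < p n ∧ p n < 1)
    (hp0 : Tendsto p atTop (𝓝 0)) : Tendsto (fun n => 1 / p n) atTop atTop := by
  simp_rw [one_div]
  exact (tendsto_nhdsWithin_iff.2 ⟨hp0, Eventually.of_forall fun n => (hp n).1⟩).inv_tendsto_nhdsGT_zero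

/-- Limits `exp ψ` of powers `f_n ^ ⌊a_n⌋` with `a_n (f_n - 1) → ψ` are infinitely divisible. -/
theorem exists_isInfDiv_of_tendsto {ν : ℕ → ProbabilityMeasure ℝ} {a : ℕ → ℝ}
    (ha : Tendsto a atTop atTop) {ψ : ℝ → ℂ} (hψ : Continuous ψ)
    (h : ∀ t, Tendsto (fun n => (a n : ℂ) * (charFun (ν n : Measure ℝ) t - 1)) atTop (𝓝 (ψ t))) :
    ∃ η : ProbabilityMeasure ℝ, IsInfDiv η ∧
      (∀ t, Complex.exp (ψ t) = charFun (η : Measure ℝ) t) ∧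
      ∀ t, Tendsto (fun n => charFun (ν n : Measure ℝ) t ^ ⌊a n⌋₊) atTop
        (𝓝 (charFun (η : Measure ℝ) t)) := by
  have key : ∀ c : ℝ, 0 ≤ c → ∀ t, Tendsto (fun n => charFun (ν n : Measure ℝ) t ^ ⌊c * a n⌋₊) atTop
      (𝓝 (Complex.exp (c * ψ t))) := fun c hc t =>
    tendsto_pow_exp_of_tendsto (tendsto_of_tendsto_mul_sub ha (h t))
      (tendsto_nat_floor_mul_sub_one ha hc (h t))
  have hlevy : ∀ c : ℝ, 0 ≤ c → ∃ η : ProbabilityMeasure ℝ, ∀ t,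
      charFun (η : Measure ℝ) t = Complex.exp (c * ψ t) := by
    intro c hc
    choose κ hκ using fun n => exists_charFun_eq_pow (ν n) ⌊c * a n⌋₊
    refine exists_charFun_eq_of_tendsto (μ := κ) (Continuous.continuousAt (by fun_prop)) fun t => ?_
    simpa only [hκ] using key c hc t
  obtain ⟨η, hη⟩ := hlevy 1 zero_le_one
  refine ⟨η, fun m hm => ?_, fun t => by simp [hη], fun t => ?_⟩
  · obtain ⟨κ, hκ⟩ := hlevy (1 / m) (by positivity)
    refine ⟨κ, fun t => ?_⟩
    have hm0 : (m : ℂ) ≠ 0 := by exact_mod_cast (by omega : m ≠ 0)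
    rw [hκ, hη, ← Complex.exp_nat_mul]
    congr 1
    push_cast
    field_simp
  · simpa [hη] using key 1 zero_le_one t

theorem LimitStationaryAlong.exists_hasGammaCF {k : ℕ} (hk : 1 ≤ k) {μ : ProbabilityMeasure ℝ}
    {p : ℕ → ℝ} (hp : ∀ n, 0 < p n ∧ p n < 1) (hp0 : Tendsto p atTop (𝓝 0))
    {ν : ℕ → ProbabilityMeasure ℝ} (h : LimitStationaryAlong k p ν μ) :
    ∃ η : ProbabilityMeasure ℝ, InnovationLimit p ν η ∧ HasGammaCF k η μ := by
  have ha := tendsto_one_div_atTop hp hp0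
  obtain ⟨ψ, hψ, hψ0, hl, hf⟩ := h.exists_log hk ha
  obtain ⟨η, hη, he, hpow⟩ := exists_isInfDiv_of_tendsto ha hψ hl
  exact ⟨η, hpow, hη, ψ, hψ, hψ0, he, hf⟩

theorem LimitStationaryAlong.isGammaID {k : ℕ} (hk : 1 ≤ k) {μ : ProbabilityMeasure ℝ}
    {p : ℕ → ℝ} (hp : ∀ n, 0 < p n ∧ p n < 1) (hp0 : Tendsto p atTop (𝓝 0))
    {ν : ℕ → ProbabilityMeasure ℝ} (h : LimitStationaryAlong k p ν μ) : IsGammaID k μ := by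
  -- With `1/θ = 1/p - 1`, the Harris denominator is `1 + (1 - s^k)/θ`, so the two generating
  -- functions coincide.
  refine ⟨1, k, hk, fun n => p n / (1 - p n), fun n => div_pos (hp n).1 (by linarith [(hp n).2]),
    ?_, ν, fun t => ?_⟩
  · have := hp0.div (hp0.const_sub 1) (by norm_num)
    rwa [zero_div] at this
  · refine (h t).congr fun n => ?_
    have h1 : (p n : ℂ) ≠ 0 := by exact_mod_cast (hp n).1.ne'
    have h2 : (1 - p n : ℂ) ≠ 0 := by exact_mod_cast (by linarith [(hp n).2] : (1 - p n) ≠ 0)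
    rw [harrisPGF, phiPGF, gammaLT, pow_one, mul_one_div]
    congr 2
    push_cast
    field_simp
    ring

theorem LimitStationaryAlong.of_innovationLimit {k : ℕ} {μ : ProbabilityMeasure ℝ}
    {p : ℕ → ℝ} (hp : ∀ n, 0 < p n ∧ p n < 1) (hp0 : Tendsto p atTop (𝓝 0))
    {ν : ℕ → ProbabilityMeasure ℝ} {η : ProbabilityMeasure ℝ} (h : InnovationLimit p ν η)
    (hG : HasGammaCF k η μ) : LimitStationaryAlong k p ν μ := by
  have ha := tendsto_one_div_atTop hp hp0
  obtain ⟨-, ψ, hψ, hψ0, he, hf⟩ := hG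
  intro t
  have hN : Tendsto (fun n => ⌊1 / p n⌋₊) atTop atTop := tendsto_nat_floor_atTop.comp ha
  have h1 := tendsto_mul_charFun_sub_one hN hψ hψ0 (fun t => by rw [he]; exact h t) t
  have hz : Tendsto (fun n => charFun (ν n : Measure ℝ) t) atTop (𝓝 1) :=
    tendsto_of_tendsto_mul_sub (tendsto_natCast_atTop_atTop.comp hN) (by simpa using h1)
  have h2 : Tendsto (fun n => ((1 / p n : ℝ) : ℂ) * (charFun (ν n : Measure ℝ) t - 1)) atTop
      (𝓝 (ψ t)) := by
    have h3 := ((Complex.continuous_ofReal.tendsto 1).comp (tendsto_nat_floor_div_atTop.comp ha)).inv₀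
      (by simp)
    have h4 := h3.mul h1
    rw [Complex.ofReal_one, inv_one, one_mul] at h4
    refine h4.congr' ?_
    filter_upwards [hN.eventually_ge_atTop 1] with n hn
    have h5 : ((⌊1 / p n⌋₊ : ℕ) : ℂ) ≠ 0 := by exact_mod_cast (by omega : ⌊1 / p n⌋₊ ≠ 0)
    simp only [Function.comp_apply, Complex.ofReal_div, Complex.ofReal_natCast]
    field_simp
  -- The derivative of `z^k` at `1` turns `(1/p)(f_ε - 1) → ψ` into `(1/p)(f_ε^k - 1) → kψ`, so the
  -- Harris denominator tends to `1 - kψ`.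
  have h6 := (hasDerivAt_pow k (1 : ℂ)).tendsto_mul_sub hz h2
  simp only [one_pow, mul_one] at h6
  have hD : Tendsto (fun n => ((1 / p n : ℝ) : ℂ) -
      (((1 / p n : ℝ) : ℂ) - 1) * charFun (ν n : Measure ℝ) t ^ k) atTop
      (𝓝 (1 + (k : ℂ) * (-ψ t))) := by
    have := (hz.pow k).sub h6
    rw [one_pow, show 1 - ψ t * k = 1 + (k : ℂ) * (-ψ t) by ring] at this
    exact this.congr fun n => by ring
  have hre := one_le_re_one_add_mul_neg_of_exp_eq_charFun (k := k) (he t)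
  rw [hf]
  refine hz.div (((continuousAt_cpow_of_one_le_re hre _).tendsto).comp hD) fun h0 => ?_
  rw [Complex.cpow_eq_zero_iff] at h0
  rw [h0.1] at hre
  norm_num at hre

/-! ### Negative binomial random sums and gamma mixtures. -/

/-- Random sums: mixtures of the convolution powers of a law. -/
theorem exists_hasSum_charFun_pow {w : ℕ → ℝ} (hw : ∀ j, 0 ≤ w j) (hw1 : HasSum w 1)
    (κ : ProbabilityMeasure ℝ) :
    ∃ ρ : ProbabilityMeasure ℝ, ∀ t : ℝ,
      HasSum (fun j => (w j : ℂ) * charFun (κ : Measure ℝ) t ^ j) (charFun (ρ : Measure ℝ) t) := by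
  choose χ hχ using fun m => exists_charFun_eq_pow κ m
  let M : ℕ → Measure ℝ := fun j => ENNReal.ofReal (w j) • (χ j : Measure ℝ)
  have hM : IsProbabilityMeasure (Measure.sum M) := by
    constructor
    simp only [M, Measure.sum_apply _ MeasurableSet.univ, Measure.smul_apply, measure_univ,
      smul_eq_mul, mul_one]
    rw [← ENNReal.ofReal_tsum_of_nonneg hw hw1.summable, hw1.tsum_eq, ENNReal.ofReal_one]
  refine ⟨⟨Measure.sum M, hM⟩, fun t => ?_⟩
  have hn : ∀ x : ℝ, ‖Complex.exp (t * x * Complex.I)‖ = 1 := fun x => by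
    simpa using Complex.norm_exp_ofReal_mul_I (t * x)
  have hi : Integrable (fun x : ℝ => Complex.exp (t * x * Complex.I)) (Measure.sum M) :=
    Integrable.of_bound (by fun_prop) 1 (ae_of_all _ fun x => (hn x).le)
  have h := hasSum_integral_measure hi
  rw [ProbabilityMeasure.coe_mk, charFun_apply_real (μ := Measure.sum M)]
  refine h.congr_fun fun j => ?_
  simp only [M]
  rw [integral_smul_measure, ← charFun_apply_real, hχ, ENNReal.toReal_ofReal (hw j),
    Complex.real_smul]

theorem Complex.hasSum_one_div_one_sub_cpow (r : ℝ) {z : ℂ} (hz : ‖z‖ < 1) :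
    HasSum (fun n : ℕ => ((Ring.choose (r + n - 1) n : ℝ) : ℂ) * z ^ n)
      (1 / (1 - z) ^ (r : ℂ)) := by
  have h := (Complex.one_div_one_sub_cpow_hasFPowerSeriesOnBall_zero (r : ℂ)).hasSum (y := z)
    (by simpa [Metric.mem_eball, edist_zero_right, enorm_eq_nnnorm, ← NNReal.coe_lt_coe] using hz)
  rw [zero_add] at h
  refine h.congr_fun fun n => ?_
  rw [FormalMultilinearSeries.ofScalars_apply_eq, Complex.ofReal_choose, smul_eq_mul]
  push_cast
  rfl

theorem Real.choose_add_sub_one_nonneg {r : ℝ} (hr : 0 < r) (n : ℕ) :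
    0 ≤ Ring.choose (r + n - 1) n := by
  rw [← Ring.multichoose_eq]
  have h := Ring.factorial_nsmul_multichoose_eq_ascPochhammer r n
  rw [Polynomial.ascPochhammer_smeval_eq_eval, nsmul_eq_mul] at h
  have h1 := ascPochhammer_pos n r hr
  rw [← h] at h1
  exact (pos_of_mul_pos_right h1 (by positivity)).le

theorem Complex.ofReal_mul_cpow {x : ℝ} (hx : 0 < x) {z : ℂ} (hz : z ≠ 0) (c : ℂ) :
    ((x : ℂ) * z) ^ c = (x : ℂ) ^ c * z ^ c := by
  have hx' : (x : ℂ) ≠ 0 := by exact_mod_cast hx.ne'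
  rw [Complex.cpow_def_of_ne_zero (mul_ne_zero hx' hz), Complex.cpow_def_of_ne_zero hx',
    Complex.cpow_def_of_ne_zero hz, Complex.log_ofReal_mul hx hz, ← Complex.exp_add, add_mul,
    Complex.ofReal_log hx.le]

/-- Negative binomial random sums. -/
theorem exists_charFun_eq_negBinomial {r b : ℝ} (hr : 0 < r) (hb : 0 ≤ b)
    (κ : ProbabilityMeasure ℝ) :
    ∃ ρ : ProbabilityMeasure ℝ, ∀ t : ℝ, charFun (ρ : Measure ℝ) t =
      1 / (1 + (b : ℂ) * (1 - charFun (κ : Measure ℝ) t)) ^ (r : ℂ) := by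
  -- `1 + b(1 - z) = (1 + b)(1 - qz)`, so the binomial series in `qz` gives nonnegative weights;
  -- setting `z = 1` shows that they sum to `1`.
  set q : ℝ := b / (1 + b) with hq
  have hb1 : 0 < 1 + b := by linarith
  have hq0 : 0 ≤ q := by positivity
  have hq1 : q < 1 := by rw [hq, div_lt_one hb1]; linarith
  have h1q : 1 - q = (1 + b)⁻¹ := by rw [hq]; field_simp; ring
  have hqc : (q : ℂ) = b / (1 + b) := by rw [hq]; push_cast; rfl
  have hb1c : (1 + b : ℂ) ≠ 0 := by exact_mod_cast hb1.ne'
  have hz : ∀ z : ℂ, ‖z‖ ≤ 1 → HasSum (fun n : ℕ =>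
      (((1 + b) ^ (-r) * (Ring.choose (r + n - 1) n * q ^ n) : ℝ) : ℂ) * z ^ n)
      (1 / (1 + (b : ℂ) * (1 - z)) ^ (r : ℂ)) := by
    intro z hz
    have h1 : ‖(q : ℂ) * z‖ < 1 := by
      rw [norm_mul, Complex.norm_real, Real.norm_of_nonneg hq0]
      nlinarith [norm_nonneg z]
    have h2 := (Complex.hasSum_one_div_one_sub_cpow r h1).mul_left (((1 + b) ^ (-r) : ℝ) : ℂ)
    have h3 : (1 - (q : ℂ) * z) = (((1 + b)⁻¹ : ℝ) : ℂ) * (1 + (b : ℂ) * (1 - z)) := by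
      rw [hqc]; push_cast; field_simp; ring
    have h4 : (1 + (b : ℂ) * (1 - z)) ≠ 0 := by
      intro h0
      rw [h0, mul_zero, sub_eq_zero] at h3
      rw [← h3, norm_one] at h1
      exact lt_irrefl _ h1
    have h5 : (((1 + b) ^ (-r) : ℝ) : ℂ) * (1 / (1 - (q : ℂ) * z) ^ (r : ℂ))
        = 1 / (1 + (b : ℂ) * (1 - z)) ^ (r : ℂ) := by
      rw [h3, Complex.ofReal_mul_cpow (inv_pos.2 hb1) h4, ← Complex.ofReal_cpow (by positivity),
        Real.inv_rpow hb1.le, ← Real.rpow_neg hb1.le, ← div_div, mul_div_assoc', mul_one_div_cancel]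
      exact_mod_cast (Real.rpow_pos_of_pos hb1 _).ne'
    rw [h5] at h2
    refine h2.congr_fun fun n => ?_
    push_cast
    ring
  have hw1 : HasSum (fun n : ℕ => (1 + b) ^ (-r) * (Ring.choose (r + n - 1) n * q ^ n)) 1 := by
    have := hz 1 (by simp)
    rw [← Complex.hasSum_ofReal]
    simpa using this
  obtain ⟨ρ, hρ⟩ := exists_hasSum_charFun_pow (fun n => mul_nonneg (Real.rpow_pos_of_pos hb1 _).le
    (mul_nonneg (Real.choose_add_sub_one_nonneg hr n) (pow_nonneg hq0 n))) hw1 κ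
  exact ⟨ρ, fun t => (hρ t).unique (hz _ (norm_charFun_le_one_coe κ t))⟩

/-- Gamma mixtures of the convolution semigroup of an infinitely divisible law. -/
theorem IsInfDiv.exists_charFun_eq_gamma {η : ProbabilityMeasure ℝ} (hη : IsInfDiv η) {ψ : ℝ → ℂ}
    (hψ : Continuous ψ) (hψ0 : ψ 0 = 0) (he : ∀ t, Complex.exp (ψ t) = charFun (η : Measure ℝ) t)
    {r c : ℝ} (hr : 0 < r) (hc : 0 ≤ c) :
    ∃ ρ : ProbabilityMeasure ℝ, ∀ t : ℝ, charFun (ρ : Measure ℝ) t =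
      1 / (1 + (c : ℂ) * (-ψ t)) ^ (r : ℂ) := by
  choose κ hκ using fun n : ℕ => hη (n + 1) (by omega)
  have hl := tendsto_mul_charFun_sub_one (ν := κ) (tendsto_add_atTop_nat 1) hψ hψ0
    (fun t => by simp_rw [← hκ, he]; exact tendsto_const_nhds)
  -- For the `(n+1)`-th root `κ_n` of `η`, `(n+1)(1 - κ_n) → -ψ`; hence the scale `b = c(n+1)`.
  choose ρ hρ using fun n : ℕ => exists_charFun_eq_negBinomial hr
    (b := c * ((n + 1 : ℕ) : ℝ)) (by positivity) (κ n)
  have hre : ∀ t, 1 ≤ (1 + (c : ℂ) * (-ψ t)).re := by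
    intro t
    have h1 : ‖Complex.exp (ψ t)‖ ≤ 1 := he t ▸ norm_charFun_le_one_coe η t
    rw [Complex.norm_exp, Real.exp_le_one_iff] at h1
    have : (1 + (c : ℂ) * (-ψ t)).re = 1 + c * (-(ψ t).re) := by simp
    rw [this]; nlinarith
  have hne : ∀ t, (1 + (c : ℂ) * (-ψ t)) ^ (r : ℂ) ≠ 0 := by
    intro t h0
    rw [Complex.cpow_eq_zero_iff] at h0
    have := hre t
    rw [h0.1] at this
    norm_num at this
  have hcont : Continuous fun t => 1 / (1 + (c : ℂ) * (-ψ t)) ^ (r : ℂ) := by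
    refine continuous_const.div (continuous_iff_continuousAt.2 fun t => ?_) hne
    exact (continuousAt_cpow_of_one_le_re (hre t) _).comp (f := fun t => 1 + (c : ℂ) * (-ψ t))
      (Continuous.continuousAt (by fun_prop))
  refine exists_charFun_eq_of_tendsto (μ := ρ) hcont.continuousAt fun t => ?_
  simp_rw [hρ]
  have h1 : Tendsto (fun n : ℕ => 1 + ((c * ((n + 1 : ℕ) : ℝ) : ℝ) : ℂ) *
      (1 - charFun (κ n : Measure ℝ) t)) atTop (𝓝 (1 + (c : ℂ) * (-ψ t))) := by
    refine (((hl t).neg.const_mul (c : ℂ)).const_add 1).congr fun n => ?_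
    push_cast; ring
  exact tendsto_const_nhds.div (((continuousAt_cpow_of_one_le_re (hre t) _).tendsto).comp h1) (hne t)

/-! ### The stationarity equation for characteristic functions. -/

theorem integrable_mul_exp {Ω : Type*} [MeasurableSpace Ω] {P : Measure Ω}
    [IsProbabilityMeasure P] {X : Ω → ℝ} (hX : Measurable X) (t : ℝ) {c : Ω → ℂ} (hc : Measurable c)
    (hc1 : ∀ ω, ‖c ω‖ ≤ 1) :
    Integrable (fun ω => c ω * Complex.exp (t * X ω * Complex.I)) P := by
  refine Integrable.of_bound (by fun_prop) 1 (ae_of_all _ fun ω => ?_)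
  rw [norm_mul]
  have : ‖Complex.exp (t * X ω * Complex.I)‖ = 1 := by
    simpa using Complex.norm_exp_ofReal_mul_I (t * X ω)
  rw [this, mul_one]
  exact hc1 ω

theorem charFun_map_apply_real {Ω : Type*} [MeasurableSpace Ω] {P : Measure Ω} {X : Ω → ℝ}
    (hX : Measurable X) (t : ℝ) :
    charFun (P.map X) t = ∫ ω, Complex.exp (t * X ω * Complex.I) ∂P := by
  rw [charFun_apply_real, integral_map hX.aemeasurable (by fun_prop)]

/-- One step of the autoregressive scheme, in terms of characteristic functions. -/
theorem charFun_map_autoregressive_step {Ω : Type*} [MeasurableSpace Ω] {P : Measure Ω}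
    [IsProbabilityMeasure P] {S E : Ω → ℝ} {B : Ω → Bool} (hS : Measurable S) (hE : Measurable E)
    (hB : Measurable B) (hind : IndepFun S (fun ω => (B ω, E ω)) P) (hBE : IndepFun B E P) {p : ℝ}
    (hp : 0 ≤ p) (hpB : P {ω | B ω = true} = ENNReal.ofReal p) (t : ℝ) :
    charFun (P.map fun ω => if B ω = true then E ω else S ω + E ω) t =
      charFun (P.map E) t * (p + (1 - p) * charFun (P.map S) t) := by
  set b : Bool → ℂ := fun x => if x = true then 1 else 0 with hb
  have hbm : Measurable b := measurable_of_finite b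
  set e : ℝ → ℂ := fun x => Complex.exp (t * x * Complex.I) with he
  have hem : Measurable e := by fun_prop
  have hb1 : ∀ x, ‖b x‖ ≤ 1 := by intro x; cases x <;> simp [hb]
  have hb2 : ∀ x, ‖1 - b x‖ ≤ 1 := by intro x; cases x <;> simp [hb]
  have hib : Integrable (fun ω => b (B ω)) P :=
    Integrable.of_bound (hbm.comp hB).aestronglyMeasurable 1 (ae_of_all _ fun ω => hb1 _)
  have hint_b : ∫ ω, b (B ω) ∂P = p := by
    have h1 : MeasurableSet {ω | B ω = true} := hB (measurableSet_singleton true)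
    have h2 : (fun ω => b (B ω)) = {ω | B ω = true}.indicator (fun _ => 1) := by
      ext ω; by_cases h : B ω = true <;> simp [hb, h]
    rw [h2, integral_indicator_const _ h1, measureReal_def, hpB, ENNReal.toReal_ofReal hp]
    simp
  have hint_b' : ∫ ω, (1 - b (B ω)) ∂P = 1 - p := by
    rw [integral_sub (integrable_const _) hib, hint_b]
    simp
  have hmeas : Measurable fun ω => if B ω = true then E ω else S ω + E ω :=
    Measurable.ite (hB (measurableSet_singleton true)) hE (hS.add hE)
  rw [charFun_map_apply_real hmeas]
  -- In the second term `S` splits off from `(B, E)`, after which `B` and `E` separate.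
  have hsplit : ∀ ω, Complex.exp (t * ((if B ω = true then E ω else S ω + E ω : ℝ) : ℂ) * Complex.I)
      = b (B ω) * e (E ω) + e (S ω) * ((1 - b (B ω)) * e (E ω)) := by
    intro ω
    by_cases h : B ω = true
    · simp [hb, he, h]
    · simp only [h, hb, he]
      simp [← Complex.exp_add]
      ring_nf
  simp_rw [hsplit]
  have h1 := hBE.integral_fun_comp_mul_comp (f := b) (g := e) hB.aemeasurable hE.aemeasurable
    hbm.aestronglyMeasurable hem.aestronglyMeasurable
  have h2 := hBE.integral_fun_comp_mul_comp (f := fun x => 1 - b x) (g := e) hB.aemeasurable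
    hE.aemeasurable (by fun_prop) hem.aestronglyMeasurable
  have h3 := hind.integral_fun_comp_mul_comp (f := e) (g := fun x : Bool × ℝ => (1 - b x.1) * e x.2)
    hS.aemeasurable (by fun_prop) hem.aestronglyMeasurable
    (Measurable.aestronglyMeasurable (by fun_prop))
  rw [integral_add (integrable_mul_exp hE t (c := fun ω => b (B ω)) (hbm.comp hB) fun _ => hb1 _),
    h1, h3, h2, hint_b,
    hint_b', charFun_map_apply_real hE, charFun_map_apply_real hS]
  · ring
  · refine Integrable.of_bound (by fun_prop) 1 (ae_of_all _ fun ω => ?_)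
    have hn : ∀ x : ℝ, ‖e x‖ = 1 := fun x => by
      rw [he]; simpa using Complex.norm_exp_ofReal_mul_I (t * x)
    rw [norm_mul, norm_mul, hn, hn, one_mul, mul_one]
    exact hb2 _

theorem IsStationaryAR.charFun_pow_eq {k : ℕ} {p : ℝ} (hp : 0 ≤ p) {μ ν : ProbabilityMeasure ℝ}
    {Ω : Type} [MeasurableSpace Ω] {P : Measure Ω} {Y ε : Fin k → ℕ → Ω → ℝ} {B : ℕ → Ω → Bool}
    (h : IsStationaryAR k p μ ν P Y ε B) (t : ℝ) :
    charFun (μ : Measure ℝ) t ^ k = charFun (ν : Measure ℝ) t ^ k *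
      (p + (1 - p) * charFun (μ : Measure ℝ) t ^ k) := by
  have := h.isProb
  have hY := h.measurable_Y
  have hε := h.measurable_ε
  have hB := h.measurable_B
  have hS : ∀ n, charFun (P.map fun ω => ∑ i, Y i n ω) t = charFun (μ : Measure ℝ) t ^ k := by
    intro n
    rw [(h.indep_Y n).charFun_map_fun_sum_eq_prod (fun i => (hY i n).aemeasurable)]
    simp [h.law_Y]
  have hE : charFun (P.map fun ω => ∑ i, ε i 1 ω) t = charFun (ν : Measure ℝ) t ^ k := by
    have h1 : iIndepFun (fun i => ε i 1) P :=
      h.indep_ε.precomp (g := fun i : Fin k => (i, 1)) (fun i j hij => by simpa using hij)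
    rw [h1.charFun_map_fun_sum_eq_prod (fun i => (hε i 1).aemeasurable)]
    simp [h.law_ε]
  have hstep := charFun_map_autoregressive_step (P := P) (S := fun ω => ∑ i, Y i 0 ω)
    (E := fun ω => ∑ i, ε i 1 ω) (B := B 1) (by fun_prop) (by fun_prop) (hB 1) ?_ ?_ hp (h.law_B 1) t
  · rw [hS, hE] at hstep
    rw [← hstep, ← hS 1]
    congr 1
    exact Measure.map_congr (h.step 0)
  · exact (h.indep_past 0).comp
      (φ := fun y : Fin k × Set.Iic 0 → ℝ => ∑ i, y (i, ⟨0, le_rfl⟩))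
      (ψ := fun z : ℕ → Bool × (Fin k → ℝ) => ((z 0).1, ∑ i, (z 0).2 i))
      (by fun_prop) (by fun_prop)
  · exact h.indep_B_ε.comp (φ := fun z : ℕ → Bool => z 1)
      (ψ := fun z : Fin k × ℕ → ℝ => ∑ i, z (i, 1)) (by fun_prop) (by fun_prop)

/-- Along `p_n → 0`, the stationarity equation for the `k`-th powers determines the
characteristic function itself. -/
theorem limitStationaryAlong_of_charFun_pow_eq {k : ℕ} (hk : 1 ≤ k) {μ : ProbabilityMeasure ℝ}
    {p : ℕ → ℝ} (hp : ∀ n, 0 < p n ∧ p n < 1) (hp0 : Tendsto p atTop (𝓝 0))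
    {ν : ℕ → ProbabilityMeasure ℝ}
    (h : ∀ n t, charFun (μ : Measure ℝ) t ^ k = charFun (ν n : Measure ℝ) t ^ k *
      (p n + (1 - p n) * charFun (μ : Measure ℝ) t ^ k)) :
    LimitStationaryAlong k p ν μ := by
  have hk0 : k ≠ 0 := by omega
  have ha := tendsto_one_div_atTop hp hp0
  have ha1 : ∀ n, 1 ≤ 1 / p n := fun n => by
    rw [le_div_iff₀ (hp n).1]; linarith [(hp n).2]
  choose κ hκ using fun n => exists_charFun_eq_pow (ν n) k
  have hre : ∀ n t, 1 ≤ (((1 / p n : ℝ) : ℂ) -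
      (((1 / p n : ℝ) : ℂ) - 1) * charFun (ν n : Measure ℝ) t ^ k).re := fun n t => by
    rw [← hκ]; exact one_le_re_harris (ha1 n) (norm_charFun_le_one_coe _ _)
  have hne : ∀ z : ℂ, 1 ≤ z.re → z ≠ 0 := fun z hz h0 => by
    rw [h0] at hz; norm_num at hz
  have heq : ∀ n t, charFun (μ : Measure ℝ) t ^ k = charFun (ν n : Measure ℝ) t ^ k /
      (((1 / p n : ℝ) : ℂ) - (((1 / p n : ℝ) : ℂ) - 1) * charFun (ν n : Measure ℝ) t ^ k) := by
    intro n t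
    rw [eq_div_iff (hne _ (hre n t))]
    have hpc : (p n : ℂ) ≠ 0 := by exact_mod_cast (hp n).1.ne'
    push_cast
    field_simp
    linear_combination h n t
  -- `f^k` is the same geometric compound for every `n`, so it is the limit of a constant sequence.
  have hf : ∀ t, charFun (μ : Measure ℝ) t ≠ 0 := by
    intro t h0
    refine ne_zero_of_tendsto_charFun_div (κ := κ) ha
      (g := fun t => charFun (μ : Measure ℝ) t ^ k) ((continuous_charFun_coe μ).pow k)
      (by simp) (fun t => ?_) t (by simp [h0, hk0])
    simp_rw [hκ, ← heq]
    exact tendsto_const_nhds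
  have hH : ∀ n t, harrisPGF (1 / p n) k (charFun (ν n : Measure ℝ) t) =
      charFun (μ : Measure ℝ) t := by
    intro n t
    refine isPreconnected_univ.eqOn_of_pow_eq (S := Set.univ) hk0
      (u := fun t => harrisPGF (1 / p n) k (charFun (ν n : Measure ℝ) t))
      (v := charFun (μ : Measure ℝ)) ?_ (continuous_charFun_coe μ).continuousOn (fun t _ => hf t)
      (fun t _ => by rw [harrisPGF_pow hk0, heq n t]) (Set.mem_univ 0) ?_ (Set.mem_univ t)
    · have hc := continuous_charFun_coe (ν n)
      refine (hc.div (continuous_iff_continuousAt.2 fun t => ?_) fun t h0 => ?_).continuousOn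
      · exact (continuousAt_cpow_of_one_le_re (hre n t) _).comp (f := fun t =>
          ((1 / p n : ℝ) : ℂ) - (((1 / p n : ℝ) : ℂ) - 1) * charFun (ν n : Measure ℝ) t ^ k)
          (Continuous.continuousAt (by fun_prop))
      · rw [Complex.cpow_eq_zero_iff] at h0
        exact hne _ (hre n t) h0.1
    · simp [harrisPGF]
  intro t
  simp_rw [hH]
  exact tendsto_const_nhds

theorem StationaryAlong.limitStationaryAlong {k : ℕ} (hk : 1 ≤ k) {μ : ProbabilityMeasure ℝ}
    {p : ℕ → ℝ} (hp : ∀ n, 0 < p n ∧ p n < 1) (hp0 : Tendsto p atTop (𝓝 0))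
    {ν : ℕ → ProbabilityMeasure ℝ} (h : StationaryAlong k p ν μ) : LimitStationaryAlong k p ν μ :=
  limitStationaryAlong_of_charFun_pow_eq hk hp hp0 fun n t => by
    obtain ⟨Ω, mΩ, P, Y, ε, B, hn⟩ := h n
    exact hn.charFun_pow_eq (hp n).1.le t

/-! ### Independence tools for building the model. -/

theorem MeasurableSpace.comap_pi_le_iSup {Ω ι γ : Type*} {E : ι → Type*}
    [∀ i, MeasurableSpace (E i)] (X : ∀ i, Ω → E i) (r : γ → ι) :
    MeasurableSpace.comap (fun ω (a : γ) => X (r a) ω) MeasurableSpace.pi ≤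
      ⨆ i ∈ Set.range r, MeasurableSpace.comap (X i) inferInstance := by
  simp only [MeasurableSpace.pi, MeasurableSpace.comap_iSup, MeasurableSpace.comap_comp]
  exact iSup_le fun a => le_iSup₂_of_le (r a) ⟨a, rfl⟩ le_rfl

section Independence

variable {Ω Ω' : Type*} [MeasurableSpace Ω] [MeasurableSpace Ω']

theorem ProbabilityTheory.iIndepFun.comp_measurePreserving {P : Measure Ω} {Q : Measure Ω'}
    [IsProbabilityMeasure P] [IsProbabilityMeasure Q] {f : Ω → Ω'} (hf : MeasurePreserving f P Q)
    {ι : Type*} {E : ι → Type*} [∀ i, MeasurableSpace (E i)] {X : ∀ i, Ω' → E i}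
    (hX : ∀ i, Measurable (X i)) (h : iIndepFun X Q) : iIndepFun (fun i ω => X i (f ω)) P := by
  have hfm := hf.measurable
  rw [iIndepFun_iff_map_fun_eq_infinitePi_map (X := fun i ω => X i (f ω))
    (fun i => (hX i).comp hfm)]
  have h1 := h.map_fun_eq_infinitePi_map hX
  have h2 : ∀ i, P.map (fun ω => X i (f ω)) = Q.map (X i) := fun i => by
    rw [← hf.map_eq, Measure.map_map (hX i) hfm]; rfl
  simp_rw [h2]
  rw [← h1, ← hf.map_eq, Measure.map_map (measurable_pi_iff.2 hX) hfm]
  rfl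

theorem ProbabilityTheory.IndepFun.comp_measurePreserving {P : Measure Ω} {Q : Measure Ω'}
    {f : Ω → Ω'} (hf : MeasurePreserving f P Q)
    {α β : Type*} [MeasurableSpace α] [MeasurableSpace β] {X : Ω' → α} {Y : Ω' → β}
    (hX : Measurable X) (hY : Measurable Y) (h : IndepFun X Y Q) :
    IndepFun (fun ω => X (f ω)) (fun ω => Y (f ω)) P := by
  rw [indepFun_iff_measure_inter_preimage_eq_mul] at h ⊢
  intro s t hs ht
  have := h s t hs ht
  rwa [← hf.measure_preimage ((hX hs).inter (hY ht)).nullMeasurableSet,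
    ← hf.measure_preimage (hX hs).nullMeasurableSet,
    ← hf.measure_preimage (hY ht).nullMeasurableSet] at this

/-- Disjoint subfamilies of an independent family are independent. -/
theorem ProbabilityTheory.iIndepFun.indepFun_of_disjoint_range {P : Measure Ω} {ι : Type*}
    {E : ι → Type*} [∀ i, MeasurableSpace (E i)] {X : ∀ i, Ω → E i} (hX : ∀ i, Measurable (X i))
    (h : iIndepFun X P) {α β : Type*} {f : α → ι} {g : β → ι}
    (hfg : Disjoint (Set.range f) (Set.range g)) :
    IndepFun (fun ω a => X (f a) ω) (fun ω b => X (g b) ω) P := by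
  have := indep_iSup_of_disjoint (fun i => (hX i).comap_le) h.iIndep hfg
  exact indep_of_indep_of_le_left (indep_of_indep_of_le_right this
    (MeasurableSpace.comap_pi_le_iSup X g)) (MeasurableSpace.comap_pi_le_iSup X f)

/-- By Fubini: for each fixed first coordinate this is independence of `X` and `Y`. It adds the
initial sum and the auxiliary uniforms to the past of the model. -/
theorem ProbabilityTheory.IndepFun.prodMk_fst {τ : Measure Ω} {ρ : Measure Ω'}
    [IsProbabilityMeasure τ] [IsProbabilityMeasure ρ] {α β : Type*} [MeasurableSpace α]
    [MeasurableSpace β] {X : Ω' → α} {Y : Ω' → β} (h : IndepFun X Y ρ) (hX : Measurable X)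
    (hY : Measurable Y) :
    IndepFun (fun z : Ω × Ω' => (z.1, X z.2)) (fun z => Y z.2) (τ.prod ρ) := by
  rw [indepFun_iff_measure_inter_preimage_eq_mul] at h ⊢
  intro s t hs ht
  have hm : Measurable fun z : Ω × Ω' => (z.1, X z.2) := by fun_prop
  have hm' : Measurable fun z : Ω × Ω' => Y z.2 := by fun_prop
  rw [Measure.prod_apply ((hm hs).inter (hm' ht)), Measure.prod_apply (hm hs)]
  have h1 : (τ.prod ρ) ((fun z : Ω × Ω' => Y z.2) ⁻¹' t) = ρ (Y ⁻¹' t) :=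
    measurePreserving_snd.measure_preimage (hY ht).nullMeasurableSet
  rw [h1, ← lintegral_mul_const _ (measurable_measure_prodMk_left (hm hs))]
  refine lintegral_congr fun x => ?_
  exact h (Prod.mk x ⁻¹' s) t (measurable_prodMk_left hs) ht

end Independence

/-! ### Stationary dynamics driven by an i.i.d. sequence. -/

/-- One step of a dynamics driven by a sequence: apply the first term and shift. -/
def driveStep {W E : Type*} (step : E → W → E) (x : E × (ℕ → W)) : E × (ℕ → W) :=
  (step x.1 (x.2 0), fun n => x.2 (n + 1))

section DriveStep

variable {W E : Type*}

theorem driveStep_iterate_snd (step : E → W → E) (n : ℕ) (x : E × (ℕ → W)) :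
    ((driveStep step)^[n] x).2 = fun m => x.2 (m + n) := by
  induction n with
  | zero => rfl
  | succ n ih =>
    rw [Function.iterate_succ_apply', driveStep, ih]
    ext m
    simp only [add_right_comm m 1 n, add_assoc]

theorem driveStep_iterate_succ_fst (step : E → W → E) (n : ℕ) (x : E × (ℕ → W)) :
    ((driveStep step)^[n + 1] x).1 = step ((driveStep step)^[n] x).1 (x.2 n) := by
  rw [Function.iterate_succ_apply', driveStep, driveStep_iterate_snd]
  simp only [zero_add]

/-- The state after `n` steps sees only the first `n` inputs, which is what makes it independent of
later noise. -/
theorem driveStep_iterate_fst_congr (step : E → W → E) (n : ℕ) (e : E) {w w' : ℕ → W}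
    (h : ∀ j < n, w j = w' j) :
    ((driveStep step)^[n] (e, w)).1 = ((driveStep step)^[n] (e, w')).1 := by
  induction n with
  | zero => rfl
  | succ n ih =>
    rw [driveStep_iterate_succ_fst, driveStep_iterate_succ_fst, ih fun j hj => h j (by omega)]
    simp only [h n (by omega)]

end DriveStep

section Shift

variable {W E : Type*} [MeasurableSpace W] [MeasurableSpace E]

theorem measurePreserving_shift (ω : Measure W) [IsProbabilityMeasure ω] :
    MeasurePreserving (fun w : ℕ → W => fun n => w (n + 1)) (Measure.infinitePi fun _ => ω)
      (Measure.infinitePi fun _ => ω) :=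
  ⟨by fun_prop, Measure.map_infinitePi_infinitePi_of_inj (P := fun _ : ℕ => ω)
    (add_left_injective 1)⟩

theorem iIndepFun_eval_infinitePi {ι : Type*} {E : ι → Type*} [∀ i, MeasurableSpace (E i)]
    (P : ∀ i, Measure (E i)) [∀ i, IsProbabilityMeasure (P i)] :
    iIndepFun (fun i (w : ∀ i, E i) => w i) (Measure.infinitePi P) :=
  iIndepFun_infinitePi (X := fun _ x => x) (fun _ => measurable_id)

theorem measurePreserving_head_shift (ω : Measure W) [IsProbabilityMeasure ω] :
    MeasurePreserving (fun w : ℕ → W => (w 0, fun n => w (n + 1))) (Measure.infinitePi fun _ => ω)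
      (ω.prod (Measure.infinitePi fun _ => ω)) := by
  refine ⟨by fun_prop, ?_⟩
  have h := (iIndepFun_eval_infinitePi fun _ : ℕ => ω).indepFun_of_disjoint_range
    (fun _ => by fun_prop) (f := fun _ : Unit => 0) (g := fun n : ℕ => n + 1) (by
      rw [Set.disjoint_left]; rintro _ ⟨_, rfl⟩ ⟨n, hn⟩; simp at hn)
  have hφ : Measurable fun a : Unit → W => a () := measurable_pi_apply ()
  have h' : IndepFun (fun w : ℕ → W => w 0) (fun w n => w (n + 1)) (Measure.infinitePi fun _ => ω) :=
    h.comp hφ measurable_id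
  have h2 := (indepFun_iff_map_prod_eq_prod_map_map (measurable_pi_apply 0).aemeasurable
    (measurePreserving_shift ω).measurable.aemeasurable).1 h'
  refine h2.trans ?_
  congr 1
  · exact Measure.infinitePi_map_eval (fun _ : ℕ => ω) 0
  · exact (measurePreserving_shift ω).map_eq

/-- Split the head off the i.i.d. sequence, regroup it with the state, and apply the step, which
preserves `σ`; the tail is again i.i.d. and independent of the new state. -/
theorem measurePreserving_driveStep {step : E → W → E} (hstep : Measurable (Function.uncurry step))
    {σ : Measure E} [IsProbabilityMeasure σ] {ω : Measure W} [IsProbabilityMeasure ω]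
    (hσ : (σ.prod ω).map (Function.uncurry step) = σ) :
    MeasurePreserving (driveStep step) (σ.prod (Measure.infinitePi fun _ => ω))
      (σ.prod (Measure.infinitePi fun _ => ω)) := by
  have h1 := (MeasurePreserving.id σ).prod (measurePreserving_head_shift ω)
  have h2 := (measurePreserving_prodAssoc σ ω (Measure.infinitePi fun _ : ℕ => ω)).symm
  have h3 := (MeasurePreserving.mk hstep hσ).prod
    (MeasurePreserving.id (Measure.infinitePi fun _ : ℕ => ω))
  exact h3.comp (h2.comp h1)

end Shift

/-! ### Construction of the stationary autoregressive model. -/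

/-- Sampling independent summands with a given sum. -/
theorem exists_measurable_sampler_of_sum {ι : Type*} [Fintype ι] (μ : ι → ProbabilityMeasure ℝ) :
    ∃ G : ℝ → unitInterval → ι → ℝ, Measurable (Function.uncurry G) ∧
      MeasurePreserving (Function.uncurry G)
        (((Measure.pi fun i => (μ i : Measure ℝ)).map fun y => ∑ i, y i).prod volume)
        (Measure.pi fun i => (μ i : Measure ℝ)) ∧
      ∀ᵐ x ∂(((Measure.pi fun i => (μ i : Measure ℝ)).map fun y => ∑ i, y i).prod
        (volume : Measure unitInterval)), ∑ i, G x.1 x.2 i = x.1 := by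
  set π := Measure.pi fun i => (μ i : Measure ℝ) with hπ
  have hs : Measurable fun y : ι → ℝ => ∑ i, y i := by fun_prop
  set σ := π.map fun y => ∑ i, y i with hσ
  have : IsProbabilityMeasure σ := Measure.isProbabilityMeasure_map hs.aemeasurable
  set K := condDistrib id (fun y : ι → ℝ => ∑ i, y i) π with hK
  obtain ⟨G, hG, hGK⟩ := Kernel.exists_measurable_map_eq_unitInterval K
  have hm : Measurable fun x : ℝ × unitInterval => (x.1, G x.1 x.2) := measurable_fst.prodMk hG
  -- A uniform variable realises the conditional law of the vector given its sum. Both claims follow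
  -- from this joint law: its second marginal, and its concentration on vectors with the prescribed
  -- sum.
  have hjoint : (σ.prod (volume : Measure unitInterval)).map (fun x => (x.1, G x.1 x.2)) =
      π.map fun y => (∑ i, y i, y) := by
    have h1 : σ ⊗ₘ K = π.map fun y => (∑ i, y i, y) :=
      compProd_map_condDistrib measurable_id.aemeasurable
    rw [← h1]
    ext A hA
    rw [Measure.map_apply hm hA, Measure.prod_apply (hm hA), Measure.compProd_apply hA]
    refine lintegral_congr fun s => ?_
    have hGs : Measurable (G s) := hG.comp measurable_prodMk_left
    rw [← hGK s, Measure.map_apply hGs (measurable_prodMk_left hA)]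
    rfl
  refine ⟨G, hG, ⟨hG, ?_⟩, ?_⟩
  · have h2 := congrArg (Measure.map Prod.snd) hjoint
    rw [Measure.map_map measurable_snd hm, Measure.map_map measurable_snd (by fun_prop)] at h2
    exact h2.trans Measure.map_id
  · have hA : MeasurableSet {z : ℝ × (ι → ℝ) | ∑ i, z.2 i = z.1} :=
      measurableSet_eq_fun (by fun_prop) (by fun_prop)
    have h3 : ∀ᵐ z ∂(σ.prod (volume : Measure unitInterval)).map (fun x => (x.1, G x.1 x.2)),
        ∑ i, z.2 i = z.1 := by
      rw [hjoint, ae_map_iff (by fun_prop) hA]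
      exact ae_of_all _ fun _ => rfl
    exact (ae_map_iff hm.aemeasurable hA).1 h3

/-- A real-valued Bernoulli law lets the decision be one more real coordinate next to the
innovations. -/
theorem exists_bernoulli_measure_Ioi {p : ℝ} (hp0 : 0 ≤ p) (hp1 : p ≤ 1) :
    ∃ β : ProbabilityMeasure ℝ, (β : Measure ℝ) (Set.Ioi 0) = ENNReal.ofReal p := by
  refine ⟨⟨ENNReal.ofReal p • Measure.dirac 1 + ENNReal.ofReal (1 - p) • Measure.dirac 0, ⟨?_⟩⟩, ?_⟩
  · simp [← ENNReal.ofReal_add hp0 (sub_nonneg.2 hp1)]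
  · simp [measurableSet_Ioi]

/-- The autoregressive recursion for the sum: the coordinate `none` decides, the others are the
innovations. -/
noncomputable def autoregressiveStep {k : ℕ} (s : ℝ) (v : Option (Fin k) → ℝ) : ℝ :=
  if 0 < v none then ∑ i, v (some i) else s + ∑ i, v (some i)

theorem measurable_autoregressiveStep (k : ℕ) :
    Measurable (Function.uncurry (autoregressiveStep (k := k))) := by
  refine Measurable.ite (measurableSet_lt measurable_const (by fun_prop)) (by fun_prop) (by fun_prop)

/-- The hypothesis says exactly that the law `σ` of the sum of `k` independent copies of `μ` is
invariant under the autoregressive step. The chain of sums is started from `σ`, and at each time a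
fresh uniform splits the current sum into summands whose joint law is `μ^k`. -/
theorem exists_isStationaryAR {k : ℕ} {p : ℝ} (hp0 : 0 ≤ p) (hp1 : p ≤ 1)
    {μ ν : ProbabilityMeasure ℝ}
    (h : ∀ t, charFun (μ : Measure ℝ) t ^ k = charFun (ν : Measure ℝ) t ^ k *
      (p + (1 - p) * charFun (μ : Measure ℝ) t ^ k)) :
    ∃ (Ω : Type) (_ : MeasurableSpace Ω) (P : Measure Ω)
      (Y ε : Fin k → ℕ → Ω → ℝ) (B : ℕ → Ω → Bool), IsStationaryAR k p μ ν P Y ε B := by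
  obtain ⟨β, hβ⟩ := exists_bernoulli_measure_Ioi hp0 hp1
  let D : Option (Fin k) → ProbabilityMeasure ℝ := fun o => o.elim β fun _ => ν
  set ω : Measure (Option (Fin k) → ℝ) := Measure.infinitePi fun o => (D o : Measure ℝ) with hω
  set ωs : Measure (ℕ → Option (Fin k) → ℝ) := Measure.infinitePi fun _ => ω with hωs
  obtain ⟨G, hG, hGm, hGs⟩ := exists_measurable_sampler_of_sum fun _ : Fin k => μ
  set π := Measure.pi fun _ : Fin k => (μ : Measure ℝ) with hπ
  have hsum : Measurable fun y : Fin k → ℝ => ∑ i, y i := by fun_prop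
  set σ := π.map fun y => ∑ i, y i with hσ
  have : IsProbabilityMeasure σ := Measure.isProbabilityMeasure_map hsum.aemeasurable
  set υ : Measure (ℕ → unitInterval) := Measure.infinitePi fun _ => volume with hυ
  let gate : ℝ → Bool := fun r => if 0 < r then true else false
  have hgate : Measurable gate :=
    Measurable.ite measurableSet_Ioi measurable_const measurable_const
  have hgate_iff : ∀ r, gate r = true ↔ 0 < r := fun r => by simp [gate]
  let T := driveStep (autoregressiveStep (k := k))
  -- invariance of the law of the sum
  have hinv : (σ.prod ω).map (Function.uncurry (autoregressiveStep (k := k))) = σ := by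
    have : IsProbabilityMeasure ((σ.prod ω).map (Function.uncurry (autoregressiveStep (k := k)))) :=
      Measure.isProbabilityMeasure_map (measurable_autoregressiveStep k).aemeasurable
    refine Measure.ext_of_charFun (funext fun t => ?_)
    have hσt : charFun σ t = charFun (μ : Measure ℝ) t ^ k := by
      rw [hσ, hπ, charFun_map_sum_pi_eq_prod]; simp
    have hfst : (σ.prod ω).map Prod.fst = σ := measurePreserving_fst.map_eq
    have hsnd : MeasurePreserving (Prod.snd : ℝ × (Option (Fin k) → ℝ) → _) (σ.prod ω) ω :=
      measurePreserving_snd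
    have hev := iIndepFun_eval_infinitePi fun o => (D o : Measure ℝ)
    have hEt : charFun ((σ.prod ω).map fun x => ∑ i, x.2 (some i)) t =
        charFun (ν : Measure ℝ) t ^ k := by
      have h1 : iIndepFun (fun (i : Fin k) (x : ℝ × (Option (Fin k) → ℝ)) => x.2 (some i))
          (σ.prod ω) :=
        (hev.precomp (Option.some_injective (Fin k))).comp_measurePreserving hsnd
          (fun i => by fun_prop)
      rw [h1.charFun_map_fun_sum_eq_prod (fun i => by fun_prop)]
      have h2 : ∀ i : Fin k, (σ.prod ω).map (fun x => x.2 (some i)) = (ν : Measure ℝ) := fun i =>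
        ((measurePreserving_eval_infinitePi (fun o => (D o : Measure ℝ)) (some i)).comp hsnd).map_eq
      simp [h2]
    have hstep := charFun_map_autoregressive_step (P := σ.prod ω) (S := Prod.fst)
      (E := fun x => ∑ i, x.2 (some i)) (B := fun x => gate (x.2 none)) measurable_fst (by fun_prop)
      (by fun_prop) ?_ ?_ hp0 ?_ t
    · rw [hEt, hfst, hσt, ← h t] at hstep
      rw [hσt, ← hstep]
      congr 2
      ext x
      simp [Function.uncurry, autoregressiveStep, hgate_iff]
    · exact (indepFun_prod (X := id) (Y := fun v : Option (Fin k) → ℝ =>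
        (gate (v none), ∑ i, v (some i))) measurable_id (by fun_prop))
    · have h1 := hev.indepFun_of_disjoint_range (fun _ => by fun_prop) (f := fun _ : Unit => none)
        (g := fun i : Fin k => some i) (by
          rw [Set.disjoint_left]; rintro _ ⟨_, rfl⟩ ⟨i, hi⟩; simp at hi)
      have h2 := h1.comp (φ := fun a : Unit → ℝ => gate (a ()))
        (ψ := fun y : Fin k → ℝ => ∑ i, y i) (by fun_prop) (by fun_prop)
      exact h2.comp_measurePreserving hsnd (by fun_prop) (by fun_prop)
    · simp only [hgate_iff]
      rw [← hβ]
      exact ((measurePreserving_eval_infinitePi (fun o => (D o : Measure ℝ)) none).comp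
        hsnd).measure_preimage measurableSet_Ioi.nullMeasurableSet
  have hT : MeasurePreserving T (σ.prod ωs) (σ.prod ωs) :=
    measurePreserving_driveStep (measurable_autoregressiveStep k) hinv
  have hR : MeasurePreserving (Prod.map id fun w : ℕ → Option (Fin k) → ℝ => fun n => w (n + 1))
      (σ.prod ωs) (σ.prod ωs) :=
    (MeasurePreserving.id σ).prod (measurePreserving_shift ω)
  let Ω := (ℕ → unitInterval) × (ℝ × (ℕ → Option (Fin k) → ℝ))
  let P : Measure Ω := υ.prod (σ.prod ωs)
  -- The noise at time `0` is dropped, so that the passage from time `n` to `n + 1` uses the noise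
  -- with index `n + 1`.
  let S : ℕ → ℝ × (ℕ → Option (Fin k) → ℝ) → ℝ := fun n x => (T^[n] (x.1, fun m => x.2 (m + 1))).1
  let Y : Fin k → ℕ → Ω → ℝ := fun i n x => G (S n x.2) (x.1 n) i
  let ε : Fin k → ℕ → Ω → ℝ := fun i n x => x.2.2 n (some i)
  let B : ℕ → Ω → Bool := fun n x => gate (x.2.2 n none)
  have hS : ∀ n, MeasurePreserving (S n) (σ.prod ωs) σ := fun n =>
    measurePreserving_fst.comp ((hT.iterate n).comp hR)
  have hSU : ∀ n, MeasurePreserving (fun x : Ω => (S n x.2, x.1 n)) P (σ.prod volume) := fun n =>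
    Measure.measurePreserving_swap.comp
      ((measurePreserving_eval_infinitePi (fun _ : ℕ => (volume : Measure unitInterval)) n).prod
        (hS n))
  have hY : ∀ n, MeasurePreserving (fun (x : Ω) i => Y i n x) P π := fun n => hGm.comp (hSU n)
  have hYm : ∀ i n, Measurable (Y i n) := fun i n => measurable_pi_iff.1 (hY n).measurable i
  have hYl : ∀ i n, P.map (Y i n) = (μ : Measure ℝ) := fun i n =>
    ((measurePreserving_eval (fun _ : Fin k => (μ : Measure ℝ)) i).comp (hY n)).map_eq
  have hw : MeasurePreserving (fun x : Ω => x.2.2) P ωs :=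
    measurePreserving_snd.comp measurePreserving_snd
  have hind : iIndepFun (fun (q : ℕ × Option (Fin k)) (w : ℕ → Option (Fin k) → ℝ) => w q.1 q.2) ωs :=
    iIndepFun_uncurry_infinitePi' (X := fun _ _ x => x) (fun _ o => (D o : Measure ℝ))
      (fun _ _ => measurable_id)
  have hwl : ∀ n o, MeasurePreserving (fun x : Ω => x.2.2 n o) P (D o : Measure ℝ) := fun n o =>
    (measurePreserving_eval_infinitePi (fun o => (D o : Measure ℝ)) o).comp
      ((measurePreserving_eval_infinitePi (fun _ : ℕ => ω) n).comp hw)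
  refine ⟨Ω, inferInstance, P, Y, ε, B, ?_⟩
  have hSs : ∀ n (x : Ω), S (n + 1) x.2 = autoregressiveStep (S n x.2) (x.2.2 (n + 1)) :=
    fun n x => driveStep_iterate_succ_fst _ n _
  exact
    { isProb := inferInstance
      measurable_Y := hYm
      measurable_ε := fun i n => by fun_prop
      measurable_B := fun n => by fun_prop
      law_Y := hYl
      indep_Y := fun n => by
        rw [iIndepFun_iff_map_fun_eq_pi_map (fun i => (hYm i n).aemeasurable)]
        simp_rw [hYl]
        exact (hY n).map_eq
      law_ε := fun i n => (hwl n (some i)).map_eq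
      indep_ε := by
        have hinj : Function.Injective fun x : Fin k × ℕ => (x.2, some x.1) := by
          rintro ⟨i, n⟩ ⟨j, m⟩ hij
          simp_all
        exact (hind.precomp hinj).comp_measurePreserving hw fun _ => by fun_prop
      law_B := fun n => by
        simp only [B, hgate_iff]
        rw [← hβ]
        exact (hwl n none).measure_preimage measurableSet_Ioi.nullMeasurableSet
      indep_B := by
        have hinj : Function.Injective fun n : ℕ => (n, (none : Option (Fin k))) := by
          rintro n m hnm
          simp_all
        exact ((hind.precomp hinj).comp (fun _ => gate) fun _ => hgate).comp_measurePreserving hw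
          fun _ => by fun_prop
      indep_B_ε := by
        have h1 := hind.indepFun_of_disjoint_range (fun _ => by fun_prop)
          (f := fun n : ℕ => (n, none)) (g := fun x : Fin k × ℕ => (x.2, some x.1)) (by
            rw [Set.disjoint_left]; rintro _ ⟨_, rfl⟩ ⟨i, hi⟩; simp at hi)
        have h2 := h1.comp (φ := fun (a : ℕ → ℝ) n => gate (a n)) (ψ := id) (by fun_prop)
          measurable_id
        exact h2.comp_measurePreserving hw (by fun_prop) (by fun_prop)
      indep_past := fun n => by
        have h1 := hind.indepFun_of_disjoint_range (fun _ => by fun_prop)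
          (f := fun q : Set.Iic n × Option (Fin k) => ((q.1 : ℕ), q.2))
          (g := fun q : ℕ × Option (Fin k) => (n + 1 + q.1, q.2)) (by
            rw [Set.disjoint_left]
            rintro _ ⟨⟨⟨a, ha⟩, o⟩, rfl⟩ ⟨b, hb⟩
            simp only [Prod.mk.injEq] at hb
            have : a ≤ n := ha
            omega)
        -- Noise after time `n` is replaced by `0`; `Y` up to time `n` does not see the change, so
        -- it is a function of the noise up to `n`, the initial sum and the uniforms.
        let fill : (Set.Iic n × Option (Fin k) → ℝ) → ℕ → Option (Fin k) → ℝ :=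
          fun a j o => if hj : j ≤ n then a (⟨j, hj⟩, o) else 0
        have hfill : Measurable fill := by
          refine measurable_pi_iff.2 fun j => measurable_pi_iff.2 fun o => ?_
          by_cases hj : j ≤ n
          · simp only [fill, hj, dite_true]; fun_prop
          · simp only [fill, hj, dite_false]; fun_prop
        have h2 := h1.comp hfill
          (ψ := fun (b : ℕ × Option (Fin k) → ℝ) (m : ℕ) =>
            (gate (b (m, none)), fun i : Fin k => b (m, some i))) (by fun_prop)
        have h3 := (h2.prodMk_fst (τ := σ) (by fun_prop) (by fun_prop)).prodMk_fst (τ := υ)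
          (by fun_prop) (by fun_prop)
        have h4 := h3.comp (φ := fun (z : Ω) (x : Fin k × Set.Iic n) => Y x.1 x.2 z) (ψ := id)
          (measurable_pi_iff.2 fun x => hYm _ _) measurable_id
        convert h4 using 1
        · ext x q
          refine congrArg (fun s => G s (x.1 q.2) q.1) ?_
          refine driveStep_iterate_fst_congr _ _ _ fun j hj => ?_
          have hq : (q.2 : ℕ) ≤ n := q.2.2
          ext o
          have hjn : j + 1 ≤ n := by omega
          simp [fill, hjn]
        · rfl
      step := fun n => by
        filter_upwards [(hSU n).quasiMeasurePreserving.ae hGs,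
          (hSU (n + 1)).quasiMeasurePreserving.ae hGs] with x h1 h2
        simp only [Y, ε, B, hgate_iff]
        rw [h1, h2, hSs]
        rfl
      stationary := by
        -- `Φ` reads off the whole process. Advancing time by one amounts to applying `T` to the
        -- chain and the shift to the uniforms, which preserves the measure.
        let Φ : Ω → Fin k × ℕ → ℝ := fun x q => G (T^[q.2] x.2).1 (x.1 q.2) q.1
        have hΦ : Measurable Φ := by
          refine measurable_pi_iff.2 fun q => ?_
          have h1 : Measurable fun x : Ω => ((T^[q.2] x.2).1, x.1 q.2) :=
            (measurable_fst.comp ((hT.iterate q.2).measurable.comp measurable_snd)).prodMk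
              ((measurable_pi_apply q.2).comp measurable_fst)
          exact (measurable_pi_apply q.1).comp (hG.comp h1)
        have hR' := (MeasurePreserving.id υ).prod hR
        have hA := ((measurePreserving_shift (volume : Measure unitInterval)).prod hT).comp hR'
        have e1 : (fun (x : Ω) (q : Fin k × ℕ) => Y q.1 q.2 x) =
            Φ ∘ (Prod.map id (Prod.map id fun w n => w (n + 1))) := rfl
        have e2 : (fun (x : Ω) (q : Fin k × ℕ) => Y q.1 (q.2 + 1) x) =
            Φ ∘ ((Prod.map (fun u n => u (n + 1)) T) ∘
              (Prod.map id (Prod.map id fun w n => w (n + 1)))) := rfl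
        rw [e1, e2, ← Measure.map_map hΦ hR'.measurable, ← Measure.map_map hΦ hA.measurable]
        exact congrArg _ (hA.map_eq.trans hR'.map_eq.symm) }

/-! ### Existence of innovations and the main theorem. -/

/-- With `f^k = 1/d` and `d = 1 - kψ`, the stationarity equation reads `f_ε^k = 1/(p d + 1 - p) =
1/(1 - p k ψ)`. This is solved by the gamma mixture with shape `1/k` and scale `p k`. -/
theorem HasGammaCF.exists_stationaryAlong {k : ℕ} (hk : 1 ≤ k) {η μ : ProbabilityMeasure ℝ}
    (h : HasGammaCF k η μ) {p : ℕ → ℝ} (hp : ∀ n, 0 < p n ∧ p n < 1) :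
    ∃ ν : ℕ → ProbabilityMeasure ℝ, StationaryAlong k p ν μ := by
  obtain ⟨hη, ψ, hψ, hψ0, he, hf⟩ := h
  have hk0 : k ≠ 0 := by omega
  have hkpos : (0 : ℝ) < 1 / k := by positivity
  choose ν hν using fun n => hη.exists_charFun_eq_gamma hψ hψ0 he hkpos
    (c := p n * k) (mul_nonneg (hp n).1.le k.cast_nonneg)
  refine ⟨ν, fun n => exists_isStationaryAR (hp n).1.le (hp n).2.le fun t => ?_⟩
  have hψre : (ψ t).re ≤ 0 := by
    have h1 : ‖Complex.exp (ψ t)‖ ≤ 1 := he t ▸ norm_charFun_le_one_coe η t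
    rwa [Complex.norm_exp, Real.exp_le_one_iff] at h1
  have hne : ∀ c : ℝ, 0 ≤ c → 1 + (c : ℂ) * (-ψ t) ≠ 0 := by
    intro c hc h0
    have h1 := congrArg Complex.re h0
    have h2 : (1 + (c : ℂ) * (-ψ t)).re = 1 + c * (-(ψ t).re) := by simp
    rw [h2, Complex.zero_re] at h1
    nlinarith
  have h1 := hne k k.cast_nonneg
  have h2 := hne (p n * k) (mul_nonneg (hp n).1.le k.cast_nonneg)
  rw [hf, hν, div_pow, div_pow, one_pow]
  have h3 : ((1 / (k : ℝ) : ℝ) : ℂ) = (k : ℂ)⁻¹ := by push_cast; rw [one_div]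
  rw [h3, one_div (k : ℂ), Complex.cpow_nat_inv_pow _ hk0, Complex.cpow_nat_inv_pow _ hk0]
  push_cast at h1 h2 ⊢
  rw [show 1 + (p n : ℂ) * k * (-ψ t) = p n * (1 + (k : ℂ) * (-ψ t)) + (1 - p n) by ring] at h2 ⊢
  generalize 1 + (k : ℂ) * (-ψ t) = d at h1 h2 ⊢
  field_simp
  rw [mul_comm] at h2
  exact (div_self h2).symm

theorem theorem4p2 (k : ℕ) (hk : 1 ≤ k) (μ : ProbabilityMeasure ℝ)
    (p : ℕ → ℝ) (hp : ∀ n, 0 < p n ∧ p n < 1) (hp0 : Tendsto p atTop (𝓝 0)) :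
    ((∃ ν : ℕ → ProbabilityMeasure ℝ, StationaryAlong k p ν μ) ↔
      (IsGammaID k μ ∧ ∃ η : ProbabilityMeasure ℝ, HasGammaCF k η μ)) ∧
    (∀ ν : ℕ → ProbabilityMeasure ℝ, StationaryAlong k p ν μ →
      ∃ η : ProbabilityMeasure ℝ, InnovationLimit p ν η ∧ HasGammaCF k η μ) ∧
    (∀ ν : ℕ → ProbabilityMeasure ℝ, LimitStationaryAlong k p ν μ ↔
      (IsGammaID k μ ∧
        ∃ η : ProbabilityMeasure ℝ, InnovationLimit p ν η ∧ HasGammaCF k η μ)) := by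
  refine ⟨⟨?_, ?_⟩, fun ν hν => ?_, fun ν => ⟨fun h => ?_, ?_⟩⟩
  · rintro ⟨ν, hν⟩
    have h := hν.limitStationaryAlong hk hp hp0
    obtain ⟨η, -, hη⟩ := h.exists_hasGammaCF hk hp hp0
    exact ⟨h.isGammaID hk hp hp0, η, hη⟩
  · rintro ⟨-, η, hη⟩
    exact hη.exists_stationaryAlong hk hp
  · exact (hν.limitStationaryAlong hk hp hp0).exists_hasGammaCF hk hp hp0
  · exact ⟨h.isGammaID hk hp hp0, h.exists_hasGammaCF hk hp hp0⟩
  · rintro ⟨-, η, hη, hG⟩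
    exact LimitStationaryAlong.of_innovationLimit hp hp0 hη hG
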